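/- There is a constant $K$ such that the following holds for all integers $n \ge 2$ and all non-empty sets $L \subseteq \{0,\dots,n-1\}^2$ such that any two distinct points $(x,y),(x',y') \in L$ satisfy $|x-x'| \ge \lceil \log_2 n\rceil$ or $|y-y'| \ge \lceil \log_2 n\rceil$. There is a tile-assembly system $\mathcal T=(T,\sigma,2)$ in the two-dimensional abstract Tile-Assembly Model (aTAM) at temperature $2$, with a seed $\sigma$ that consists of a single tile, with $|T| \le K\,|L|\log_2 n$ tile types, and with a colour assigned to each tile type, such that $\mathcal T$ weakly self-assembles the $n \times n$ pattern on $\{0,\dots,n-1\}^2$ that is black at the points of $L$ and white at all other points. Here a tile type is a unit square with a glue (a label and a strength in $\mathbb N$, with a single glue of strength $0$) on each of its four sides. Adjacent tiles are bound, with the strength of their common glue, if the glues on their abutting sides are equal and of positive strength. An assembly is a partial map $\mathbb Z^2 \dashrightarrow T$ with non-empty connected domain. It is $\tau$-stable if every cut of the weighted graph of its bonds has weight at least $\tau$. Starting from $\sigma$, tiles are added one at a time, finitely or infinitely often, such that each assembly of the sequence is $2$-stable. The last assembly of such a sequence, or the union of its assemblies if it is infinite, is producible, and a producible assembly is terminal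 if it is $2$-stable and no tile can be added to it so that the result is $2$-stable. "Weakly self-assembles" means that in every producible terminal assembly the set of locations of black or white tiles is exactly $\{0,\dots,n-1\}^2$, and each of these tiles has the colour that the pattern prescribes. The colours are taken from an arbitrary set that contains black and white; in particular black and white alone suffice. -/

import Mathlib

/-! The two-dimensional abstract Tile-Assembly Model (aTAM) and self-assembly of coloured
patterns. -/

namespace ATAM

open Classical

/-- A location of the lattice `ℤ²`. -/
abbrev Point : Type := ℤ × ℤ

/-- The four sides of a tile. -/
inductive Dir : Type
  | north
  | east
  | south
  | west

/-- The unit vector that points out of the given side. -/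
def Dir.vec : Dir → Point
  | .north => (0, 1)
  | .east => (1, 0)
  | .south => (0, -1)
  | .west => (-1, 0)

/-- The side of the neighbouring tile that abuts the given side. -/
def Dir.opp : Dir → Dir
  | .north => .south
  | .east => .west
  | .south => .north
  | .west => .east

/-- A glue: a label (a finite string over the binary alphabet) together with a strength.
There is only one glue of strength `0`, the null glue; its label is the empty string. -/
@[ext]
structure Glue : Type where
  label : List Bool
  strength : ℕ
  null_label : strength = 0 → label = []

/-- A tile type: a unit square with a glue on each of its four sides. -/
abbrev TileType : Type := Dir → Glue

/-- A configuration over the tile set `T`: a partial function from `ℤ²` to `T`. -/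
abbrev Configuration (T : Finset TileType) : Type := Point → Option T

variable {T : Finset TileType}

/-- The set of locations that carry a tile. -/
def shape (α : Configuration T) : Set Point := {p | α p ≠ none}

/-- The grid graph on `ℤ²`: locations at distance one are adjacent. -/
def latticeGraph : SimpleGraph Point where
  Adj p q := |p.1 - q.1| + |p.2 - q.2| = 1
  symm := ⟨fun p q h => by rw [abs_sub_comm q.1, abs_sub_comm q.2]; exact h⟩
  loopless := ⟨fun p h => by simp at h⟩

/-- An assembly is a configuration whose domain is connected and non-empty. -/
def IsAssembly (α : Configuration T) : Prop := (latticeGraph.induce (shape α)).Connected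

/-- The weight of the edge of the binding graph between `p` and its neighbour in direction `d`:
the strength of the common glue if both locations are occupied and the glues on the abutting sides
are equal, and `0` (no edge) otherwise. -/
noncomputable def bond (α : Configuration T) (p : Point) (d : Dir) : ℕ :=
  match α p, α (p + d.vec) with
  | some s, some t => if s.1 d = t.1 d.opp then (s.1 d).strength else 0
  | _, _ => 0

/-- An assembly is `τ`-stable if every cut of its binding graph has weight at least `τ`. A cut is
given by one of its two sides `A`. A pair `(p, d)` with `p` in `A` and the neighbour of `p` in
direction `d` on the other side describes an edge across the cut, each such edge exactly once.
As the assembly may be infinite, "the total weight is at least `τ`" is expressed by a finite set of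
crossing edges of total weight at least `τ`. -/
def IsStable (τ : ℕ) (α : Configuration T) : Prop :=
  IsAssembly α ∧
    ∀ A ⊆ shape α, A.Nonempty → (shape α \ A).Nonempty →
      ∃ F : Finset (Point × Dir),
        (∀ e ∈ F, e.1 ∈ A ∧ e.1 + e.2.vec ∈ shape α \ A) ∧
          τ ≤ ∑ e ∈ F, bond α e.1 e.2

/-- `α ⊑ β`: the configuration `β` has the tiles of `α` in all locations of `α`. -/
def IsSubassembly (α β : Configuration T) : Prop := ∀ p ∈ shape α, β p = α p

/-- A tile-assembly system. -/
structure TAS : Type where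
  /-- the tile set -/
  tiles : Finset TileType
  /-- the seed assembly -/
  seed : Configuration tiles
  /-- the binding threshold, or temperature -/
  temp : ℕ
  temp_pos : 0 < temp
  seed_finite : (shape seed).Finite
  seed_stable : IsStable temp seed

/-- The seed consists of a single tile. -/
def TAS.SinglySeeded (S : TAS) : Prop := (shape S.seed).encard = 1

/-- `α` produces `β` in one step: both are stable, and `β` is `α` with one tile added. -/
def TAS.Step (S : TAS) (α β : Configuration S.tiles) : Prop :=
  IsStable S.temp α ∧ IsStable S.temp β ∧ IsSubassembly α β ∧ (shape β \ shape α).encard = 1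

/-- `α` produces `β`: there is an assembly sequence that starts with `α` and has result `β`. The
result of a finite sequence is its last assembly; the result of an infinite sequence consists of
all the tiles of all its assemblies. -/
def TAS.Produces (S : TAS) (α β : Configuration S.tiles) : Prop :=
  Relation.ReflTransGen S.Step α β ∨
    ∃ s : ℕ → Configuration S.tiles, s 0 = α ∧ (∀ i, S.Step (s i) (s (i + 1))) ∧
      ∀ p t, β p = some t ↔ ∃ i, s i p = some t

/-- The assemblies that the system produces from its seed. -/
def TAS.producible (S : TAS) : Set (Configuration S.tiles) := {α | S.Produces S.seed α}

/-- The producible assemblies that are terminal: they are stable and no tile can be added. -/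
def TAS.terminal (S : TAS) : Set (Configuration S.tiles) :=
  {α | α ∈ S.producible ∧ IsStable S.temp α ∧ ∀ β, ¬ S.Step α β}

variable {C : Type*}

/-- A pattern: a set of locations with colours. -/
abbrev Pattern (C : Type*) : Type _ := Set (Point × C)

/-- The set of locations to which a pattern assigns a colour. -/
def Pattern.dom (P : Pattern C) : Set Point := {p | ∃ c, (p, c) ∈ P}

/-- The colour of the tile of `α` at `p`, undefined if there is no tile. -/
def colorAt (color : T → C) (α : Configuration T) (p : Point) : Option C := (α p).map color

/-- The set of locations of the tiles of `α` whose colour lies in `D`. -/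
def colorDom (color : T → C) (D : Set C) (α : Configuration T) : Set Point :=
  {p | ∃ c ∈ D, colorAt color α p = some c}

/-- The system `S`, with tile types coloured by `color`, weakly self-assembles the pattern `P`,
whose colours are the set `D`: in every terminal assembly the tiles with colours in `D` occupy
exactly the domain of `P`, and they have the colours that `P` prescribes. -/
def TAS.WeaklySelfAssembles (S : TAS) (color : S.tiles → C) (D : Set C) (P : Pattern C) : Prop :=
  ∀ α ∈ S.terminal, colorDom color D α = P.dom ∧ ∀ p c, (p, c) ∈ P → colorAt color α p = some c

/-- The `n × n` square `{0, …, n - 1}²`. -/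
def square (n : ℕ) : Set Point := {p | 0 ≤ p.1 ∧ p.1 < n ∧ 0 ≤ p.2 ∧ p.2 < n}

/-- The pattern on the `n × n` square that is black on `L` and white elsewhere. -/
noncomputable def multiPixel (black white : C) (n : ℕ) (L : Finset Point) : Pattern C :=
  {q | q.1 ∈ square n ∧ q.2 = if q.1 ∈ L then black else white}

end ATAM

namespace ATAM

open Classical

/-! A tile is hard-coded if its input glue names its location; this costs one tile type per
location. With h = ⌊log₂ n⌋ + 1, the budget allows O(|L|) hard-coded lines of O(h) tiles each.
Everything between these lines has to be built from few types.

The square is organised as a comb. The spine is a vertical strip of width h. The rows are cut into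
slabs of height at least h and less than 2h, and the slabs that meet L, as well as the lowest one,
become teeth: horizontal strips from the spine to the east side. The lines across a strip come in
pairs. A pair is hard-coded if it contains the first or last line of the strip, a point of L or, in
the spine, the start of a tooth.

From one hard-coded pair to the next runs a binary counter of the width w ≥ h of the strip. The
first line of a pair increments the counter from the low to the high end; the second carries the sum
back, together with an overflow flag. The counter starts at 2^w minus the number of pairs up to the
next hard-coded one, so that it overflows exactly on arrival; n ≤ 2^h guarantees enough bits
(`exists_soft`). Only the counter tiles at the low end remember the next hard-coded location, so
counters cost O(1) types per hard-coded location (`card_image_label_le`). One more type, bound from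
the south and the west, fills the rest of the square.

Correctness is that of a deterministic process. Each label is an output of one tile and an input of
its neighbour, and `Blueprint` isolates what is needed: inputs come from tiles of smaller rank, have
total strength at least 2, and determine the tile. Then producible assemblies are parts of the
blueprint closed under inputs (`IsPart.of_step`), and an incomplete stable part can grow
(`IsPart.exists_step`), so the blueprint is the only terminal assembly. All points of L are
hard-coded, and a hard-coded type occurs only once (`IsHard.eq_of_label_eq`), so these types can be
coloured black. -/

noncomputable instance : Fintype Dir where
  elems := {.north, .east, .south, .west}
  complete d := by cases d <;> simp

@[simp]
theorem Dir.opp_opp (d : Dir) : d.opp.opp = d := by cases d <;> rfl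

theorem Dir.vec_opp (d : Dir) : d.opp.vec = -d.vec := by cases d <;> rfl

@[simp]
theorem Dir.add_vec_add_opp_vec (p : Point) (d : Dir) : p + d.vec + d.opp.vec = p := by
  rw [Dir.vec_opp]; abel

theorem latticeGraph_adj_add_vec (p : Point) (d : Dir) : latticeGraph.Adj p (p + d.vec) := by
  cases d <;> simp [latticeGraph, Dir.vec]

/-! ### Bonds, and stability when one tile is added -/

variable {T : Finset TileType}

theorem mem_shape {α : Configuration T} {p : Point} : p ∈ shape α ↔ ∃ t, α p = some t := by
  simp [shape, Option.ne_none_iff_exists']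

theorem bond_of_eq_some {α : Configuration T} {p : Point} {d : Dir} {s t : T} (hs : α p = some s)
    (ht : α (p + d.vec) = some t) :
    bond α p d = if s.1 d = t.1 d.opp then (s.1 d).strength else 0 := by
  simp [bond, hs, ht]

theorem bond_opp (α : Configuration T) (p : Point) (d : Dir) :
    bond α (p + d.vec) d.opp = bond α p d := by
  unfold bond
  rw [Dir.add_vec_add_opp_vec, Dir.opp_opp]
  cases α p <;> cases α (p + d.vec) <;> simp
  split_ifs with h1 h2 h2 <;> simp_all

theorem bond_congr {α β : Configuration T} {p : Point} {d : Dir} (h : β p = α p)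
    (h' : β (p + d.vec) = α (p + d.vec)) : bond β p d = bond α p d := by
  simp [bond, h, h']

theorem shape_update (α : Configuration T) (p : Point) (t : T) :
    shape (Function.update α p (some t)) = insert p (shape α) := by
  ext q
  by_cases h : q = p <;> simp [shape, h]

/-- A single tile is stable at every temperature. -/
theorem isStable_of_shape_eq_singleton {τ : ℕ} {α : Configuration T} {p : Point}
    (h : shape α = {p}) : IsStable τ α := by
  constructor
  · unfold IsAssembly
    rw [h]
    have : Nonempty ({p} : Set Point) := ⟨p, rfl⟩
    exact ⟨fun u v => by rw [Subsingleton.elim u v]⟩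
  · rintro A hA ⟨a, ha⟩ ⟨b, hb, hbA⟩
    rw [h] at hA hb
    rw [Set.mem_singleton_iff.1 hb, ← Set.mem_singleton_iff.1 (hA ha)] at hbA
    exact absurd ha hbA

/-- Adding a tile that is bound with total strength at least `τ` preserves stability. -/
theorem IsStable.update {τ : ℕ} {α : Configuration T} (hα : IsStable τ α) {p : Point}
    (hp : p ∉ shape α) (t : T) (D : Finset Dir) (hne : D.Nonempty)
    (hD : ∀ d ∈ D, p + d.vec ∈ shape α)
    (hs : τ ≤ ∑ d ∈ D, bond (Function.update α p (some t)) p d) :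
    IsStable τ (Function.update α p (some t)) := by
  set β := Function.update α p (some t) with hβ
  have hshape : shape β = insert p (shape α) := shape_update α p t
  have hbα : ∀ q ∈ shape α, β q = α q := fun q hq =>
    Function.update_of_ne (by rintro rfl; exact hp hq) _ _
  constructor
  · obtain ⟨d, hd⟩ := hne
    have h1 := SimpleGraph.induce_pair_connected_of_adj (latticeGraph_adj_add_vec p d)
    have h2 := SimpleGraph.induce_union_connected h1.preconnected hα.1.preconnected
      ⟨p + d.vec, by simp, hD d hd⟩
    unfold IsAssembly
    have h3 : insert p (shape α) = {p, p + d.vec} ∪ shape α := by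
      rw [Set.insert_union, Set.singleton_union, Set.insert_eq_of_mem (hD d hd)]
    rw [hshape, h3]
    exact h2
  · intro A hA hA1 hA2
    -- A cut that splits `α` is heavy enough already within `α`. Every other cut separates `p` from
    -- all of `α`, on one side or the other, and the bonds of the new tile cross it.
    by_cases h1 : (A ∩ shape α).Nonempty
    · by_cases h2 : (shape α \ A).Nonempty
      · obtain ⟨F, hF, hF2⟩ := hα.2 (A ∩ shape α) Set.inter_subset_right h1 (by
          obtain ⟨q, hq⟩ := h2
          exact ⟨q, hq.1, fun h => hq.2 h.1⟩)
        refine ⟨F, fun e he => ⟨(hF e he).1.1, ?_, fun h => ?_⟩, ?_⟩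
        · rw [hshape]; exact Or.inr (hF e he).2.1
        · exact (hF e he).2.2 ⟨h, (hF e he).2.1⟩
        · refine hF2.trans (le_of_eq (Finset.sum_congr rfl fun e he => ?_))
          exact (bond_congr (hbα _ (hF e he).1.2) (hbα _ (hF e he).2.1)).symm
      · have hsub : shape α ⊆ A := fun q hq => by
          by_contra h
          exact h2 ⟨q, hq, h⟩
        have hpA : p ∉ A := by
          obtain ⟨q, hq, hqA⟩ := hA2
          rw [hshape] at hq
          rcases hq with rfl | hq
          · exact hqA
          · exact absurd (hsub hq) hqA
        refine ⟨D.image fun d => (p + d.vec, d.opp), ?_, ?_⟩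
        · intro e he
          obtain ⟨d, hd, rfl⟩ := Finset.mem_image.1 he
          refine ⟨hsub (hD d hd), ?_, ?_⟩ <;> simp only [Dir.add_vec_add_opp_vec]
          · rw [hshape]; exact Or.inl rfl
          · exact hpA
        · rw [Finset.sum_image]
          · simpa only [bond_opp] using hs
          · intro d _ d' _ h
            simpa using congrArg Dir.opp (Prod.ext_iff.1 h).2
    · have hA' : A = {p} := by
        refine Set.Subset.antisymm (fun q hq => ?_) ?_
        · have := hA hq
          rw [hshape] at this
          rcases this with h | h
          · exact h
          · exact absurd ⟨q, hq, h⟩ h1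
        · obtain ⟨q, hq⟩ := hA1
          have := hA hq
          rw [hshape] at this
          rcases this with h | h
          · intro r hr; rw [Set.mem_singleton_iff.1 hr, ← h]; exact hq
          · exact absurd ⟨q, hq, h⟩ h1
      refine ⟨D.image fun d => (p, d), ?_, ?_⟩
      · intro e he
        obtain ⟨d, hd, rfl⟩ := Finset.mem_image.1 he
        refine ⟨by simp [hA'], ?_, ?_⟩
        · rw [hshape]; exact Or.inr (hD d hd)
        · rw [hA']
          intro h
          exact hp ((Set.mem_singleton_iff.1 h) ▸ hD d hd)
      · rw [Finset.sum_image]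
        · exact hs
        · intro d _ d' _ h
          exact (Prod.ext_iff.1 h).2

/-- A tile that has been added to form a stable assembly is bound with total strength at least
the temperature. -/
theorem IsStable.le_sum_bond {τ : ℕ} {β : Configuration T} (hβ : IsStable τ β) {p q : Point}
    (hp : p ∈ shape β) (hq : q ∈ shape β) (hpq : q ≠ p) : τ ≤ ∑ d, bond β p d := by
  obtain ⟨F, hF, hF2⟩ := hβ.2 {p} (by simpa using hp) ⟨p, rfl⟩ ⟨q, hq, by simpa using hpq⟩
  have hFp : ∀ e ∈ F, e = (p, e.2) := fun e he => Prod.ext (hF e he).1 rfl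
  calc τ ≤ ∑ e ∈ F, bond β e.1 e.2 := hF2
    _ = ∑ e ∈ F, bond β p e.2 := Finset.sum_congr rfl fun e he => by
        rw [Set.mem_singleton_iff.1 (hF e he).1]
    _ = ∑ d ∈ F.image Prod.snd, bond β p d := by
        rw [Finset.sum_image]
        intro e he e' he' h
        rw [hFp e he, hFp e' he', h]
    _ ≤ ∑ d, bond β p d := Finset.sum_le_sum_of_subset (Finset.subset_univ _)

/-! ### Blueprints: deterministic assembly from labels -/

/-- A finite assembly described by labels on the sides of its tiles. A label has strength `1`
or `2`; `inn` tells on which sides of a tile a label is an input. Each tile but the first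
has either one input of strength `2` or two inputs of strength `1`, which are
supplied by tiles of smaller rank, and the labels offered to a location determine the tile. -/
structure Blueprint (Λ : Type) where
  two : Λ → Bool
  inn : Λ → Dir → Prop
  inn_opp : ∀ a d, inn a d.opp ↔ ¬ inn a d
  region : Finset Point
  label : Point → Dir → Option Λ
  start : Point
  start_mem : start ∈ region
  rank : Point → ℕ
  start_inputs : ∀ d a, label start d = some a → ¬ inn a d
  supplied : ∀ p ∈ region, ∀ d a, label p d = some a → inn a d →
    p + d.vec ∈ region ∧ label (p + d.vec) d.opp = some a ∧ rank (p + d.vec) < rank p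
  inputs : ∀ p ∈ region, p ≠ start →
    (∃ d a, (label p d = some a ∧ inn a d) ∧ two a = true ∧
      ∀ d' a', label p d' = some a' → inn a' d' → d' = d) ∨
    (∃ d a d' a', d ≠ d' ∧ (label p d = some a ∧ inn a d) ∧ (label p d' = some a' ∧ inn a' d') ∧
      ∀ d'' a'', label p d'' = some a'' → inn a'' d'' →
        two a'' = false ∧ (d'' = d ∨ d'' = d'))
  determined_one : ∀ p, ∀ r ∈ region, ∀ d a, label r d = some a → inn a d → two a = true →
    p + d.vec ∈ region → label (p + d.vec) d.opp = some a → p ∈ region ∧ label p = label r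
  determined_two : ∀ p, ∀ r ∈ region, ∀ d a d' a', d ≠ d' →
    label r d = some a → inn a d → p + d.vec ∈ region → label (p + d.vec) d.opp = some a →
    label r d' = some a' → inn a' d' → p + d'.vec ∈ region →
      label (p + d'.vec) d'.opp = some a' → p ∈ region ∧ label p = label r

namespace Blueprint

variable {Λ : Type} [Countable Λ] (B : Blueprint Λ)

/-- The glue that represents a label. -/
noncomputable def glue : Option Λ → Glue
  | none => ⟨[], 0, fun _ => rfl⟩
  | some a => ⟨List.replicate (Classical.choose (exists_injective_nat Λ) a) true,
      if B.two a then 2 else 1, fun h => by split_ifs at h⟩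

/-- Strength 0 is reserved for the absence of a label, and labels are coded by unary words of
different lengths. -/
theorem glue_injective : Function.Injective B.glue := by
  have hinj := Classical.choose_spec (exists_injective_nat Λ)
  intro a b h
  cases a <;> cases b
  · rfl
  · have := congrArg Glue.strength h
    simp only [glue] at this
    split_ifs at this
  · have := congrArg Glue.strength h
    simp only [glue] at this
    split_ifs at this
  · have := congrArg (fun g => g.label.length) h
    simp only [glue, List.length_replicate] at this
    rw [hinj this]

/-- The tile type at a location. -/
noncomputable def tile (p : Point) : TileType := fun d => B.glue (B.label p d)

theorem tile_eq_tile {p q : Point} : B.tile p = B.tile q ↔ B.label p = B.label q := by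
  constructor
  · intro h
    funext d
    exact B.glue_injective (congrFun h d)
  · intro h
    funext d
    simp [tile, h]

/-- The tile set. -/
noncomputable def tiles : Finset TileType := B.region.image B.tile

theorem tile_mem {p : Point} (hp : p ∈ B.region) : B.tile p ∈ B.tiles :=
  Finset.mem_image_of_mem _ hp

/-- The seed: the tile at the start. -/
noncomputable def seed : Configuration B.tiles :=
  fun p => if p = B.start then some ⟨B.tile B.start, B.tile_mem B.start_mem⟩ else none

theorem shape_seed : shape B.seed = {B.start} := by
  ext p
  by_cases h : p = B.start <;> simp [shape, seed, h]

/-- The tile-assembly system of a blueprint. -/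
noncomputable def system : TAS where
  tiles := B.tiles
  seed := B.seed
  temp := 2
  temp_pos := two_pos
  seed_finite := by rw [shape_seed]; exact Set.finite_singleton _
  seed_stable := isStable_of_shape_eq_singleton B.shape_seed

/-- A part of the blueprint that contains the start and with each tile all of its inputs. -/
structure IsPart (β : Configuration B.tiles) : Prop where
  start_mem : B.start ∈ shape β
  mem_region : ∀ p ∈ shape β, p ∈ B.region
  eq_tile : ∀ p t, β p = some t → t.1 = B.tile p
  input_mem : ∀ p ∈ shape β, ∀ d a, B.label p d = some a → B.inn a d → p + d.vec ∈ shape β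

theorem isPart_seed : B.IsPart B.seed where
  start_mem := by rw [shape_seed]; rfl
  mem_region p hp := by
    rw [shape_seed] at hp
    rw [Set.mem_singleton_iff.1 hp]
    exact B.start_mem
  eq_tile p t h := by
    unfold seed at h
    split_ifs at h with hp
    rw [hp, ← Option.some.inj h]
  input_mem p hp d a h h' := by
    rw [shape_seed] at hp
    rw [Set.mem_singleton_iff.1 hp] at h
    exact absurd h' (B.start_inputs d a h)

variable {B}

/-- A new tile cannot bind by an output: the neighbour would have that label as an input, and a part
that contains the neighbour contains the supplier already. So the new tile binds by inputs only, and
these determine it. -/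
theorem IsPart.of_step {α β : Configuration B.tiles} (hα : B.IsPart α)
    (h : B.system.Step α β) : B.IsPart β := by
  obtain ⟨-, hβ, hsub, hcard⟩ := h
  obtain ⟨p, hp⟩ := Set.encard_eq_one.1 hcard
  have hpβ : p ∈ shape β := (hp.symm.subset rfl : p ∈ shape β \ shape α).1
  have hpα : p ∉ shape α := (hp.symm.subset rfl : p ∈ shape β \ shape α).2
  have hmem : ∀ q ∈ shape β, q ≠ p → q ∈ shape α := fun q hq hqp => by
    by_contra hqα
    exact hqp (hp.subset ⟨hq, hqα⟩)
  have hαβ : shape α ⊆ shape β := fun q hq => by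
    unfold shape
    rw [Set.mem_ofPred_eq, hsub q hq]
    exact hq
  obtain ⟨t, ht⟩ := mem_shape.1 hpβ
  obtain ⟨r, hr, hrt⟩ := Finset.mem_image.1 t.2
  have hstart : B.start ≠ p := fun h => hpα (h ▸ hα.start_mem)
  have hsum := hβ.le_sum_bond hpβ (hαβ hα.start_mem) hstart
  -- a positive bond of the new tile uses one of its input labels
  have key : ∀ d, bond β p d ≠ 0 → ∃ a, B.label r d = some a ∧ B.inn a d ∧
      p + d.vec ∈ shape α ∧ B.label (p + d.vec) d.opp = some a ∧
      bond β p d = if B.two a then 2 else 1 := by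
    intro d hd
    have hq : p + d.vec ∈ shape β := by
      by_contra hq
      have : β (p + d.vec) = none := by simpa [shape] using hq
      simp [bond, ht, this] at hd
    have hqp : p + d.vec ≠ p := by cases d <;> simp [Dir.vec, Prod.ext_iff]
    have hqα := hmem _ hq hqp
    obtain ⟨u, hu⟩ := mem_shape.1 hqα
    have hu' : β (p + d.vec) = some u := by rw [hsub _ hqα, hu]
    rw [bond_of_eq_some ht hu'] at hd ⊢
    rw [← hrt, hα.eq_tile _ _ hu] at hd ⊢
    have hg : B.tile r d = B.tile (p + d.vec) d.opp := by
      by_contra hg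
      simp [hg] at hd
    rw [if_pos hg] at hd ⊢
    have hl := B.glue_injective hg
    cases hla : B.label r d with
    | none => simp [tile, hla, glue] at hd
    | some a =>
      rw [hla] at hl
      refine ⟨a, rfl, ?_, hqα, hl.symm, by simp [tile, hla, glue]⟩
      by_contra hin
      have := hα.input_mem _ hqα d.opp a hl.symm ((B.inn_opp a d).2 hin)
      rw [Dir.add_vec_add_opp_vec] at this
      exact hpα this
  have hmain : p ∈ B.region ∧ B.label p = B.label r ∧
      ∀ d a, B.label p d = some a → B.inn a d → p + d.vec ∈ shape α := by
    -- Strength 2 comes from one label of strength 2 or from two different sides of strength 1. In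
    -- either case `inputs` shows that the tile has no inputs besides those used, so all its inputs
    -- are present.
    by_cases h2 : ∃ d, 2 ≤ bond β p d
    · obtain ⟨d, hd⟩ := h2
      obtain ⟨a, h1, h2, h3, h4, h5⟩ := key d (by omega)
      have ha : B.two a = true := by
        by_contra h
        rw [if_neg h] at h5
        omega
      obtain ⟨hpR, hpr⟩ := B.determined_one p r hr d a h1 h2 ha (hα.mem_region _ h3) h4
      refine ⟨hpR, hpr, fun d' a' h6 h7 => ?_⟩
      rw [← hpr] at h1
      rcases B.inputs p hpR hstart.symm with ⟨e, b, -, -, he⟩ | ⟨e, b, e', b', -, -, -, he⟩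
      · rw [he d' a' h6 h7, ← he d a h1 h2]
        exact h3
      · have := (he d a h1 h2).1
        rw [ha] at this
        cases this
    · push Not at h2
      have hex : ∃ d d', d ≠ d' ∧ bond β p d ≠ 0 ∧ bond β p d' ≠ 0 := by
        by_contra hcon
        push Not at hcon
        have hne : ∃ d, bond β p d ≠ 0 := by
          by_contra h
          push Not at h
          have h0 : ∑ d, bond β p d = 0 := Finset.sum_eq_zero fun d _ => h d
          have : (2 : ℕ) ≤ ∑ d, bond β p d := hsum
          omega
        obtain ⟨d, hd⟩ := hne
        have h0 : ∑ d, bond β p d = bond β p d :=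
          Finset.sum_eq_single d (fun d' _ h => hcon d d' h.symm hd) (by simp)
        have h1 : (2 : ℕ) ≤ ∑ d, bond β p d := hsum
        have := h2 d
        omega
      obtain ⟨d, d', hdd, hd, hd'⟩ := hex
      obtain ⟨a, h1, h2, h3, h4, -⟩ := key d hd
      obtain ⟨a', h1', h2', h3', h4', -⟩ := key d' hd'
      obtain ⟨hpR, hpr⟩ := B.determined_two p r hr d a d' a' hdd h1 h2 (hα.mem_region _ h3) h4
        h1' h2' (hα.mem_region _ h3') h4'
      refine ⟨hpR, hpr, fun d'' a'' h6 h7 => ?_⟩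
      rw [← hpr] at h1 h1'
      rcases B.inputs p hpR hstart.symm with ⟨e, b, -, -, he⟩ | ⟨e, b, e', b', -, -, -, he⟩
      · exact absurd ((he d a h1 h2).trans (he d' a' h1' h2').symm) hdd
      · have e1 := (he d a h1 h2).2
        have e2 := (he d' a' h1' h2').2
        have e3 := (he d'' a'' h6 h7).2
        have : d'' = d ∨ d'' = d' := by
          rcases e1 with rfl | rfl <;> rcases e2 with rfl | rfl <;> tauto
        rcases this with rfl | rfl
        · exact h3
        · exact h3'
  refine ⟨hαβ hα.start_mem, fun q hq => ?_, fun q u hu => ?_, fun q hq d a h h' => ?_⟩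
  · by_cases hqp : q = p
    · rw [hqp]; exact hmain.1
    · exact hα.mem_region _ (hmem q hq hqp)
  · by_cases hqp : q = p
    · subst hqp
      rw [ht] at hu
      rw [← Option.some.inj hu, ← hrt, B.tile_eq_tile, hmain.2.1]
    · have := hmem q (mem_shape.2 ⟨u, hu⟩) hqp
      rw [hsub q this] at hu
      exact hα.eq_tile q u hu
  · by_cases hqp : q = p
    · subst hqp
      exact hαβ (hmain.2.2 d a h h')
    · exact hαβ (hα.input_mem q (hmem q hq hqp) d a h h')

/-- The conditions on a part concern one tile and its neighbours, so they pass to the union of an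
infinite sequence. -/
theorem IsPart.of_producible {α : Configuration B.tiles} (hα : α ∈ B.system.producible) :
    B.IsPart α := by
  rcases hα with h | ⟨s, h0, hs, hα⟩
  · induction h with
    | refl => exact B.isPart_seed
    | tail _ h ih => exact ih.of_step h
  · have hpart : ∀ i, B.IsPart (s i) := fun i => by
      induction i with
      | zero => rw [h0]; exact B.isPart_seed
      | succ i ih => exact ih.of_step (hs i)
    have hmem : ∀ p, p ∈ shape α ↔ ∃ i, p ∈ shape (s i) := fun p => by
      simp only [mem_shape]
      constructor
      · rintro ⟨t, ht⟩
        obtain ⟨i, hi⟩ := (hα p t).1 ht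
        exact ⟨i, t, hi⟩
      · rintro ⟨i, t, ht⟩
        exact ⟨t, (hα p t).2 ⟨i, ht⟩⟩
    refine ⟨(hmem _).2 ⟨0, (hpart 0).start_mem⟩, fun p hp => ?_, fun p t ht => ?_,
      fun p hp d a h h' => ?_⟩
    · obtain ⟨i, hi⟩ := (hmem p).1 hp
      exact (hpart i).mem_region p hi
    · obtain ⟨i, hi⟩ := (hα p t).1 ht
      exact (hpart i).eq_tile p t hi
    · obtain ⟨i, hi⟩ := (hmem p).1 hp
      exact (hmem _).2 ⟨i, (hpart i).input_mem p hi d a h h'⟩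

/-- A stable part of the blueprint that misses some tile can grow. -/
theorem IsPart.exists_step {α : Configuration B.tiles} (hα : B.IsPart α) (hst : IsStable 2 α)
    (hne : ∃ p ∈ B.region, p ∉ shape α) : ∃ β, B.system.Step α β := by
  -- A missing location of least rank has all its inputs in place.
  obtain ⟨p, ⟨hpR, hpα⟩, hmin⟩ :=
    exists_minimalFor_of_wellFoundedLT (fun p => p ∈ B.region ∧ p ∉ shape α) B.rank hne
  have hstart : p ≠ B.start := fun h => hpα (h ▸ hα.start_mem)
  set t : B.tiles := ⟨B.tile p, B.tile_mem hpR⟩ with ht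
  have hin : ∀ d a, B.label p d = some a → B.inn a d → p + d.vec ∈ shape α := by
    intro d a h h'
    obtain ⟨h1, h2, h3⟩ := B.supplied p hpR d a h h'
    by_contra h4
    exact absurd (hmin ⟨h1, h4⟩ h3.le) (not_le.2 h3)
  have hbond : ∀ d a, B.label p d = some a → B.inn a d →
      bond (Function.update α p (some t)) p d = if B.two a then 2 else 1 := by
    intro d a h h'
    obtain ⟨u, hu⟩ := mem_shape.1 (hin d a h h')
    have hqp : p + d.vec ≠ p := by cases d <;> simp [Dir.vec, Prod.ext_iff]
    have hlab := (B.supplied p hpR d a h h').2.1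
    rw [bond_of_eq_some (s := t) (t := u) (by simp) (by rw [Function.update_of_ne hqp, hu]),
      hα.eq_tile _ _ hu]
    simp [ht, tile, h, hlab, glue]
  have hstable : IsStable 2 (Function.update α p (some t)) := by
    rcases B.inputs p hpR hstart with ⟨d, a, ⟨h1, h2⟩, h3, -⟩ |
      ⟨d, a, d', a', hdd, ⟨h1, h2⟩, ⟨h1', h2'⟩, -⟩
    · refine hst.update hpα t {d} (by simp) ?_ ?_
      · simpa using hin d a h1 h2
      · simp [hbond d a h1 h2, h3]
    · refine hst.update hpα t {d, d'} (by simp) ?_ ?_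
      · simp only [Finset.mem_insert, Finset.mem_singleton]
        rintro e (rfl | rfl)
        · exact hin _ a h1 h2
        · exact hin _ a' h1' h2'
      · rw [Finset.sum_pair hdd, hbond d a h1 h2, hbond d' a' h1' h2']
        split_ifs <;> omega
  refine ⟨Function.update α p (some t), hst, hstable, fun q hq => ?_, ?_⟩
  · exact Function.update_of_ne (by rintro rfl; exact hpα hq) _ _
  · rw [Set.encard_eq_one]
    refine ⟨p, ?_⟩
    change shape (T := B.tiles) (Function.update α p (some t)) \ shape (T := B.tiles) α = {p}
    rw [shape_update]
    ext q
    simp only [Set.mem_sdiff, Set.mem_insert_iff, Set.mem_singleton_iff]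
    constructor
    · tauto
    · rintro rfl
      exact ⟨Or.inl rfl, hpα⟩

/-- The only terminal assembly is the blueprint itself. -/
theorem exists_eq_some_of_mem_terminal {α : Configuration B.tiles} (hα : α ∈ B.system.terminal) :
    ∀ p, (p ∈ B.region → ∃ t, α p = some t ∧ t.1 = B.tile p) ∧ (p ∉ B.region → α p = none) := by
  obtain ⟨hprod, hst, hterm⟩ := hα
  have hpart := IsPart.of_producible hprod
  intro p
  constructor
  · intro hp
    by_cases h : p ∈ shape α
    · obtain ⟨t, ht⟩ := mem_shape.1 h
      exact ⟨t, ht, hpart.eq_tile p t ht⟩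
    · obtain ⟨β, hβ⟩ := hpart.exists_step hst ⟨p, hp, h⟩
      exact absurd hβ (hterm β)
  · intro hp
    by_contra h
    exact hp (hpart.mem_region p h)

variable (B)

/-- The system of a blueprint weakly self-assembles each pattern on its region in which
the black locations do not share their tile type with white ones. -/
theorem exists_weaklySelfAssembles {C : Type*} {black white : C} {L : Finset Point}
    (hL : ∀ p ∈ L, ∀ q ∈ B.region, B.label q = B.label p → q ∈ L) {P : Pattern C}
    (hP : ∀ q, q ∈ P ↔ q.1 ∈ B.region ∧ q.2 = if q.1 ∈ L then black else white) :
    ∃ (S : TAS) (color : S.tiles → C), S.temp = 2 ∧ S.SinglySeeded ∧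
      S.tiles.card ≤ (B.region.image B.label).card ∧
      S.WeaklySelfAssembles color {black, white} P := by
  refine ⟨B.system, fun t => if ∃ p ∈ L, t.1 = B.tile p then black else white, rfl, ?_, ?_, ?_⟩
  · unfold TAS.SinglySeeded
    change (shape B.seed).encard = 1
    rw [shape_seed, Set.encard_singleton]
  · have : B.tiles = (B.region.image B.label).image (fun l d => B.glue (l d)) := by
      rw [Finset.image_image]
      rfl
    change B.tiles.card ≤ _
    rw [this]
    exact Finset.card_image_le
  · intro α hα
    have hterm := exists_eq_some_of_mem_terminal hα
    have hcolor : ∀ p ∈ B.region,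
        colorAt (fun t : B.tiles => if ∃ p ∈ L, t.1 = B.tile p then black else white) α p =
          some (if p ∈ L then black else white) := by
      intro p hp
      obtain ⟨t, ht, htp⟩ := (hterm p).1 hp
      simp only [colorAt, ht, Option.map_some, htp]
      congr 1
      by_cases hpL : p ∈ L
      · rw [if_pos hpL, if_pos ⟨p, hpL, rfl⟩]
      · rw [if_neg hpL, if_neg]
        rintro ⟨q, hq, h⟩
        exact hpL (hL q hq p hp (B.tile_eq_tile.1 h))
    constructor
    · ext p
      constructor
      · rintro ⟨c, -, h⟩
        by_cases hp : p ∈ B.region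
        · exact ⟨if p ∈ L then black else white, (hP (p, _)).2 ⟨hp, rfl⟩⟩
        · have hnone : α p = none := (hterm p).2 hp
          simp [colorAt, hnone] at h
      · rintro ⟨c, h⟩
        refine ⟨_, ?_, hcolor p ((hP _).1 h).1⟩
        split_ifs <;> simp
    · intro p c h
      obtain ⟨h1, h2⟩ := (hP _).1 h
      rw [show c = _ from h2]
      exact hcolor p h1

end Blueprint

/-! ### Binary increment -/

/-- The carry into position `a` when `c` is incremented. -/
def carryBit (c a : ℕ) : Bool := decide (2 ^ a ∣ c + 1)

theorem carryBit_zero (c : ℕ) : carryBit c 0 = true := by simp [carryBit]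

/-- Passing from c to c + 1 raises the quotient by 2^a exactly when 2^a divides c + 1, that is, when
all lower bits of c are 1. -/
theorem testBit_add_one (c a : ℕ) : (c + 1).testBit a = (c.testBit a ^^ carryBit c a) := by
  rw [Nat.testBit_eq_decide_div_mod_eq, Nat.testBit_eq_decide_div_mod_eq, Nat.succ_div, carryBit]
  by_cases h : 2 ^ a ∣ c + 1
  · rcases Nat.mod_two_eq_zero_or_one (c / 2 ^ a) with h2 | h2 <;> simp [h, Nat.add_mod, h2]
  · simp [h]

theorem carryBit_add_one (c a : ℕ) : carryBit c (a + 1) = (c.testBit a && carryBit c a) := by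
  rw [Nat.testBit_eq_decide_div_mod_eq, carryBit, carryBit, ← Bool.decide_and, decide_eq_decide]
  by_cases h : 2 ^ a ∣ c + 1
  · have h1 : (c + 1) / 2 ^ a = c / 2 ^ a + 1 := by rw [Nat.succ_div, if_pos h]
    rw [pow_succ, ← Nat.dvd_div_iff_mul_dvd h, h1]
    simp only [h, and_true]
    omega
  · simp only [h, and_false, iff_false]
    exact fun h' => h ((pow_dvd_pow 2 (Nat.le_succ a)).trans h')

/-- The overflow signal: a counter of w bits that starts v steps before 2^w overflows at the last of
these steps only. -/
theorem carryBit_two_pow_sub {w v : ℕ} (h1 : 1 ≤ v) (h2 : v ≤ 2 ^ w) :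
    carryBit (2 ^ w - v) w = decide (v = 1) := by
  rw [carryBit, decide_eq_decide]
  constructor
  · intro h
    have := Nat.le_of_dvd (by omega) h
    omega
  · rintro rfl
    rw [Nat.sub_add_cancel h2]

/-! ### Labels -/

/-- The labels of a comb. The flag `o` tells the teeth (`true`) from the spine (`false`). -/
inductive CombLabel : Type
  | enter (p : Point)
  | start (o : Bool) (p : Point) (b : Bool)
  | bit (o b last : Bool)
  | carry (o c : Bool)
  | turn (o b f : Bool)
  | copy (o b : Bool)
  | home (o : Bool) (p : Point) (b : Bool)
  | flag (o f : Bool)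
  | fill (o : Bool)

namespace CombLabel

/-- A faithful description of a label by a tuple. -/
def toTuple : CombLabel → ℕ × Bool × Point × Bool × Bool
  | enter p => (0, false, p, false, false)
  | start o p b => (1, o, p, b, false)
  | bit o b l => (2, o, 0, b, l)
  | carry o c => (3, o, 0, c, false)
  | turn o b f => (4, o, 0, b, f)
  | copy o b => (5, o, 0, b, false)
  | home o p b => (6, o, p, b, false)
  | flag o f => (7, o, 0, f, false)
  | fill o => (8, o, 0, false, false)

instance : Countable CombLabel :=
  Function.Injective.countable (f := toTuple) fun a b h => by
    cases a <;> cases b <;> simp_all [toTuple]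

/-- The labels of strength `2`. -/
def two : CombLabel → Bool
  | enter _ => true
  | start _ _ _ => true
  | turn _ _ _ => true
  | _ => false

end CombLabel

/-- The sides to the south and to the west. -/
def Dir.isLow : Dir → Bool
  | .south => true
  | .west => true
  | _ => false

/-- The sides of a tile on which a label is an input: information flows to the north and to the
east, except for flags, which flow to the south and to the west. -/
def CombLabel.inn : CombLabel → Dir → Prop
  | .flag _ _, d => d.isLow = false
  | _, d => d.isLow = true

theorem CombLabel.inn_opp (a : CombLabel) (d : Dir) : a.inn d.opp ↔ ¬ a.inn d := by
  cases a <;> cases d <;> simp [inn, Dir.opp, Dir.isLow]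

/-- The reflection in the diagonal of the sides, for `o = true`. -/
def Dir.tr : Bool → Dir → Dir
  | false, d => d
  | true, .north => .east
  | true, .east => .north
  | true, .south => .west
  | true, .west => .south

@[simp]
theorem Dir.tr_tr (o : Bool) (d : Dir) : Dir.tr o (Dir.tr o d) = d := by
  cases o <;> cases d <;> rfl

@[simp]
theorem Dir.isLow_tr (o : Bool) (d : Dir) : (Dir.tr o d).isLow = d.isLow := by
  cases o <;> cases d <;> rfl

theorem Dir.opp_tr (o : Bool) (d : Dir) : (Dir.tr o d).opp = Dir.tr o d.opp := by
  cases o <;> cases d <;> rfl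

@[simp]
theorem CombLabel.inn_tr (a : CombLabel) (o : Bool) (d : Dir) : a.inn (Dir.tr o d) ↔ a.inn d := by
  cases a <;> simp [inn]

/-! ### Counter tiles and their local determinism -/

/-- The tiles of the counters, up to orientation. The first two process a line of digits from the
low to the high end and increment it, the other three copy the result on the way back. -/
inductive Soft : Type
  | lead (p : Point) (b : Bool)
  | add (b last c : Bool)
  | turn (b f : Bool)
  | copy (b f : Bool)
  | home (p : Point) (b f : Bool)

/-- The location that a counter tile knows. -/
def Soft.target : Soft → Option Point
  | .lead p _ => some p
  | .home p _ _ => some p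
  | _ => none

/-- The labels of a counter tile of a vertical strip. -/
def Soft.label (o : Bool) : Soft → Dir → Option CombLabel
  | .lead p b, .south => some (.start o p b)
  | .lead p b, .north => some (.home o p (!b))
  | .lead _ _, .west => none
  | .lead _ b, .east => some (.carry o b)
  | .add b l _, .south => some (.bit o b l)
  | .add b l c, .north => if l then some (.turn o (b ^^ c) (b && c)) else some (.copy o (b ^^ c))
  | .add _ _ c, .west => some (.carry o c)
  | .add b l c, .east => if l then some (.fill o) else some (.carry o (b && c))
  | .turn b f, .south => some (.turn o b f)
  | .turn b f, .north => if f then none else some (.bit o b true)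
  | .turn _ f, .west => some (.flag o f)
  | .turn _ _, .east => some (.fill o)
  | .copy b _, .south => some (.copy o b)
  | .copy b f, .north => if f then none else some (.bit o b false)
  | .copy _ f, .west => some (.flag o f)
  | .copy _ f, .east => some (.flag o f)
  | .home p b _, .south => some (.home o p b)
  | .home p b f, .north => if f then some (.enter p) else some (.start o p b)
  | .home _ _ _, .west => none
  | .home _ _ f, .east => some (.flag o f)

/-- The inputs of the counter tiles. -/
inductive Soft.Input (o : Bool) : Soft → Dir → CombLabel → Prop
  | lead (p b) : Soft.Input o (.lead p b) .south (.start o p b)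
  | add_bit (b l c) : Soft.Input o (.add b l c) .south (.bit o b l)
  | add_carry (b l c) : Soft.Input o (.add b l c) .west (.carry o c)
  | turn (b f) : Soft.Input o (.turn b f) .south (.turn o b f)
  | copy_bit (b f) : Soft.Input o (.copy b f) .south (.copy o b)
  | copy_flag (b f) : Soft.Input o (.copy b f) .east (.flag o f)
  | home_bit (p b f) : Soft.Input o (.home p b f) .south (.home o p b)
  | home_flag (p b f) : Soft.Input o (.home p b f) .east (.flag o f)

/-- With the inputs listed as an inductive family, determinism becomes an inspection of eight
constructors. -/
theorem Soft.input_iff {o : Bool} {s : Soft} {d : Dir} {a : CombLabel} :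
    s.label o d = some a ∧ a.inn d ↔ s.Input o d a := by
  constructor
  · rintro ⟨h, hin⟩
    cases s <;> cases d <;> simp only [label] at h <;> (try split_ifs at h) <;> cases h <;>
      first
      | constructor
      | simp [CombLabel.inn, Dir.isLow] at hin
  · rintro (_ | _ | _ | _ | _ | _ | _ | _) <;> simp [label, CombLabel.inn, Dir.isLow]

/-- A counter tile is determined by an input of strength `2`. -/
theorem Soft.Input.eq_of_two {o o' : Bool} {s s' : Soft} {d d' : Dir} {a : CombLabel}
    (h : s.Input o d a) (h' : s'.Input o' d' a) (ha : a.two = true) : o = o' ∧ s = s' := by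
  cases h <;> first | cases ha; done | (cases h'; exact ⟨rfl, rfl⟩)

/-- A counter tile is determined by two inputs. -/
theorem Soft.Input.eq_of_ne {o o' : Bool} {s s' : Soft} {d e d' e' : Dir} {a b : CombLabel}
    (h : s.Input o d a) (g : s.Input o e b) (hde : d ≠ e) (h' : s'.Input o' d' a)
    (g' : s'.Input o' e' b) : o = o' ∧ s = s' := by
  cases h <;> cases g <;> first
    | exact absurd rfl hde
    | (cases h' <;> cases g' <;> exact ⟨rfl, rfl⟩)

/-- A counter tile has one input of strength `2` or two inputs of strength `1`. -/
theorem Soft.inputs (o : Bool) (s : Soft) :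
    (∃ d a, s.Input o d a ∧ a.two = true ∧ ∀ d' a', s.Input o d' a' → d' = d) ∨
    (∃ d a d' a', d ≠ d' ∧ s.Input o d a ∧ s.Input o d' a' ∧
      ∀ d'' a'', s.Input o d'' a'' → a''.two = false ∧ (d'' = d ∨ d'' = d')) := by
  cases s with
  | lead p b => exact Or.inl ⟨_, _, .lead p b, rfl, fun d a h => by cases h; rfl⟩
  | add b l c =>
    exact Or.inr ⟨_, _, _, _, by simp, .add_bit b l c, .add_carry b l c,
      fun d a h => by cases h <;> simp [CombLabel.two]⟩
  | turn b f => exact Or.inl ⟨_, _, .turn b f, rfl, fun d a h => by cases h; rfl⟩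
  | copy b f =>
    exact Or.inr ⟨_, _, _, _, by simp, .copy_bit b f, .copy_flag b f,
      fun d a h => by cases h <;> simp [CombLabel.two]⟩
  | home p b f =>
    exact Or.inr ⟨_, _, _, _, by simp, .home_bit p b f, .home_flag p b f,
      fun d a h => by cases h <;> simp [CombLabel.two]⟩

/-! ### The comb and the labels of its strips -/

/-- The layout of a comb in the `n × n` square: a vertical spine of width `h` along the west side,
and horizontal teeth from the spine to the east side. The rows are divided
into slabs of height at least `h`: row `y` lies in the slab of the rows from `st y` to
`en (st y) - 1`. The slabs that start in `teeth` are teeth, the others are filled with one tile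
type. Lines of a strip are grouped in pairs, and those with index in `hp` are
hard-coded. The spine is the strip `none`, the tooth that starts in row `s` is `some s`. -/
structure Comb where
  n : ℕ
  h : ℕ
  st : ℕ → ℕ
  en : ℕ → ℕ
  teeth : Set ℕ
  hp : Option ℕ → Set ℕ
  two_le : 2 ≤ h
  h_le : h ≤ n
  n_le : n ≤ 2 ^ h
  st_le : ∀ y, st y ≤ y
  lt_en : ∀ y < n, y < en (st y)
  en_le : ∀ y < n, en (st y) ≤ n
  st_eq : ∀ y < n, ∀ y', st y ≤ y' → y' < en (st y) → st y' = st y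
  st_en : ∀ y < n, en (st y) < n → st (en (st y)) = en (st y)
  height : ∀ y < n, st y + h ≤ en (st y)
  zero_mem : 0 ∈ teeth
  teeth_lt : ∀ s ∈ teeth, s < n
  teeth_st : ∀ s ∈ teeth, st s = s
  hp_zero : n % 2 / 2 ∈ hp none
  hp_teeth : ∀ s ∈ teeth, (s + n % 2) / 2 ∈ hp none
  hp_h : ∀ s, (h + n % 2) / 2 ∈ hp (some s)
  hp_last : ∀ σ, (n - 1 + n % 2) / 2 ∈ hp σ

namespace Comb

variable (C : Comb)

/-- The index of the pair of a line. -/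
def pr (l : ℕ) : ℕ := (l + C.n % 2) / 2

/-- The position of a line in its pair. -/
def ph (l : ℕ) : ℕ := (l + C.n % 2) % 2

/-- The width of a strip. -/
def wd : Option ℕ → ℕ
  | none => C.h
  | some s => C.en s - s

/-- The first line of a strip. -/
def first : Option ℕ → ℕ
  | none => 0
  | some _ => C.h

/-- The location at position `a` of line `l` of a strip. -/
def place : Option ℕ → ℕ → ℕ → Point
  | none, a, l => (a, l)
  | some s, a, l => (l, s + a)

/-- The positions of the strips. -/
structure Valid (σ : Option ℕ) (a l : ℕ) : Prop where
  mem_teeth : ∀ s ∈ σ, s ∈ C.teeth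
  lt_wd : a < C.wd σ
  first_le : C.first σ ≤ l
  lt_n : l < C.n

/-- The index of the next hard-coded pair. -/
noncomputable def nx (σ : Option ℕ) (P : ℕ) : ℕ := sInf {q | q ∈ C.hp σ ∧ P < q}

/-- The value of the counter on arrival at a pair of lines. It overflows when the next
pair is hard-coded. -/
noncomputable def cnt (σ : Option ℕ) (P : ℕ) : ℕ := 2 ^ C.wd σ - (C.nx σ P - P)

/-- Whether the next pair is hard-coded. -/
noncomputable def fin (σ : Option ℕ) (P : ℕ) : Bool := decide (P + 1 ∈ C.hp σ)

/-- The first location of the next hard-coded pair. -/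
noncomputable def entry (σ : Option ℕ) (P : ℕ) : Point := place σ 0 (2 * C.nx σ P - C.n % 2)

/-- The label between the lines `l - 1` and `l`. -/
noncomputable def back (σ : Option ℕ) (a l : ℕ) : Option CombLabel :=
  if C.pr l ∈ C.hp σ then
    if a = 0 ∧ (σ = none → l ≠ 0) then some (.enter (place σ a l)) else none
  else if C.ph l = 0 then
    if a = 0 then
      some (.start σ.isSome (C.entry σ (C.pr l)) ((C.cnt σ (C.pr l)).testBit 0))
    else some (.bit σ.isSome ((C.cnt σ (C.pr l)).testBit a) (decide (a + 1 = C.wd σ)))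
  else
    if a + 1 = C.wd σ then
      some (.turn σ.isSome ((C.cnt σ (C.pr l) + 1).testBit a) (C.fin σ (C.pr l)))
    else if a = 0 then
      some (.home σ.isSome (C.entry σ (C.pr l)) ((C.cnt σ (C.pr l) + 1).testBit 0))
    else some (.copy σ.isSome ((C.cnt σ (C.pr l) + 1).testBit a))

/-- The label between the positions `a - 1` and `a` of a line. -/
noncomputable def low (σ : Option ℕ) (a l : ℕ) : Option CombLabel :=
  if a = 0 then none
  else if C.pr l ∈ C.hp σ then some (.enter (place σ a l))
  else if C.ph l = 0 then some (.carry σ.isSome (carryBit (C.cnt σ (C.pr l)) a))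
  else some (.flag σ.isSome (C.fin σ (C.pr l)))

/-- The label at the high end of a line. -/
noncomputable def out (σ : Option ℕ) (l : ℕ) : Option CombLabel :=
  if σ = none ∧ l ∈ C.teeth ∧ C.h < C.n then some (.enter (place (some l) 0 C.h))
  else some (.fill σ.isSome)

/-- The labels of a tile of a strip, where the teeth are reflected in the diagonal. -/
noncomputable def strip (σ : Option ℕ) (a l : ℕ) : Dir → Option CombLabel
  | .south => C.back σ a l
  | .north => if l + 1 < C.n then C.back σ a (l + 1) else none
  | .west => C.low σ a l
  | .east => if a + 1 < C.wd σ then C.low σ (a + 1) l else C.out σ l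

/-! ### Counters between hard-coded pairs -/

variable {C}

theorem Valid.le_wd {σ : Option ℕ} {a l : ℕ} (h : C.Valid σ a l) : C.h ≤ C.wd σ := by
  cases σ with
  | none => exact le_rfl
  | some s =>
    have hs := h.mem_teeth s rfl
    have := C.height s (C.teeth_lt s hs)
    rw [C.teeth_st s hs] at this
    simp only [wd]
    omega

theorem Valid.wd_le {σ : Option ℕ} {a l : ℕ} (h : C.Valid σ a l) : C.wd σ ≤ C.n := by
  cases σ with
  | none => exact C.h_le
  | some s =>
    have hs := h.mem_teeth s rfl
    have := C.en_le s (C.teeth_lt s hs)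
    rw [C.teeth_st s hs] at this
    simp only [wd]
    omega

theorem pr_last_mem (σ : Option ℕ) : C.pr (C.n - 1) ∈ C.hp σ := C.hp_last σ

theorem pr_first_mem (σ : Option ℕ) : C.pr (C.first σ) ∈ C.hp σ := by
  cases σ with
  | none => simpa [pr, first] using C.hp_zero
  | some s => exact C.hp_h s

theorem lt_pr_last {σ : Option ℕ} {l : ℕ} (hl : l < C.n) (hs : C.pr l ∉ C.hp σ) :
    C.pr l < C.pr (C.n - 1) := by
  have h1 : C.pr l ≠ C.pr (C.n - 1) := fun h => hs (h ▸ pr_last_mem σ)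
  unfold pr at *
  omega

/-- The last pair is always hard-coded, so the infimum is over a non-empty set and is attained. -/
theorem nx_spec {σ : Option ℕ} {P : ℕ} (h : P < C.pr (C.n - 1)) :
    C.nx σ P ∈ C.hp σ ∧ P < C.nx σ P :=
  Nat.sInf_mem (s := {q | q ∈ C.hp σ ∧ P < q}) ⟨_, pr_last_mem σ, h⟩

theorem nx_le {σ : Option ℕ} {P q : ℕ} (hq : q ∈ C.hp σ) (h : P < q) : C.nx σ P ≤ q :=
  Nat.sInf_le ⟨hq, h⟩

theorem nx_of_mem {σ : Option ℕ} {P : ℕ} (h : P < C.pr (C.n - 1)) (hf : P + 1 ∈ C.hp σ) :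
    C.nx σ P = P + 1 := by
  have h1 := nx_le hf (Nat.lt_succ_self P)
  have h2 := (nx_spec (σ := σ) h).2
  omega

theorem nx_add_one {σ : Option ℕ} {P : ℕ} (hf : P + 1 ∉ C.hp σ) :
    C.nx σ (P + 1) = C.nx σ P := by
  unfold nx
  congr 1
  ext q
  simp only [Set.mem_ofPred_eq]
  constructor
  · rintro ⟨h1, h2⟩
    exact ⟨h1, by omega⟩
  · rintro ⟨h1, h2⟩
    have : q ≠ P + 1 := fun h => hf (h ▸ h1)
    exact ⟨h1, by omega⟩

/-- There are at most n pairs ahead and n ≤ 2^h, so the width of a strip provides enough bits and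
the subtraction in `cnt` is not truncated. -/
theorem nx_sub_le {σ : Option ℕ} {P : ℕ} (h : P < C.pr (C.n - 1)) (hw : C.h ≤ C.wd σ) :
    C.nx σ P - P ≤ 2 ^ C.wd σ := by
  have h1 := nx_le (pr_last_mem σ) h
  have h2 : C.pr (C.n - 1) ≤ C.n := by
    have := C.two_le
    have := C.h_le
    unfold pr
    omega
  have h3 := C.n_le
  have h4 : 2 ^ C.h ≤ 2 ^ C.wd σ := Nat.pow_le_pow_right two_pos hw
  omega

/-- The flag, defined by the layout, is what the counter computes by local rules: its carry out of
the highest digit. -/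
theorem fin_eq_carryBit {σ : Option ℕ} {P : ℕ} (h : P < C.pr (C.n - 1)) (hw : C.h ≤ C.wd σ) :
    C.fin σ P = carryBit (C.cnt σ P) (C.wd σ) := by
  have h2 := (nx_spec (σ := σ) h).2
  unfold fin cnt
  rw [carryBit_two_pow_sub (by omega) (nx_sub_le h hw), decide_eq_decide]
  constructor
  · intro hf
    rw [nx_of_mem h hf]
    omega
  · intro h3
    rw [show P + 1 = C.nx σ P by omega]
    exact (nx_spec h).1

theorem cnt_add_one {σ : Option ℕ} {P : ℕ} (h : P < C.pr (C.n - 1)) (hw : C.h ≤ C.wd σ)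
    (hf : P + 1 ∉ C.hp σ) : C.cnt σ (P + 1) = C.cnt σ P + 1 := by
  have h1 := nx_sub_le h hw
  have h2 := nx_spec (σ := σ) h
  have h3 : C.nx σ P ≠ P + 1 := fun h3 => hf (h3 ▸ h2.1)
  unfold cnt
  rw [nx_add_one hf]
  omega

/-- The tiles of a strip that are not hard-coded are counter tiles. -/
theorem exists_soft {σ : Option ℕ} {a l : ℕ} (h : C.Valid σ a l) (hs : C.pr l ∉ C.hp σ) :
    ∃ s : Soft, C.strip σ a l = s.label σ.isSome ∧
      ∀ p ∈ s.target, p = C.entry σ (C.pr l) := by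
  have hw := h.le_wd
  have h2 := C.two_le
  have ha := h.lt_wd
  have hl := h.lt_n
  have hP := lt_pr_last hl hs
  have hl1 : l + 1 < C.n := by unfold pr at hP; omega
  -- The lines of the spine at which teeth start are hard-coded, so a counter line never has to open
  -- a tooth.
  have hout : C.out σ l = some (.fill σ.isSome) := by
    unfold out
    rw [if_neg]
    rintro ⟨rfl, hlt, -⟩
    exact hs (C.hp_teeth l hlt)
  by_cases hph : C.ph l = 0
  · have hpr : C.pr (l + 1) = C.pr l := by unfold pr ph at *; omega
    have hph1 : ¬ C.ph (l + 1) = 0 := by unfold ph at *; omega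
    by_cases ha0 : a = 0
    · subst ha0
      refine ⟨.lead (C.entry σ (C.pr l)) ((C.cnt σ (C.pr l)).testBit 0), ?_, by simp [Soft.target]⟩
      funext d
      -- The width is at least 2, so the two ends of a line are different tiles.
      have h0 : ¬ 0 + 1 = C.wd σ := by omega
      have h1 : 1 < C.wd σ := by omega
      cases d <;>
        simp [strip, Soft.label, back, low, hl1, hpr, hs, hph, hph1, h0, h1, testBit_add_one,
          carryBit_zero, carryBit_add_one]
    · refine ⟨.add ((C.cnt σ (C.pr l)).testBit a) (decide (a + 1 = C.wd σ))
        (carryBit (C.cnt σ (C.pr l)) a), ?_, by simp [Soft.target]⟩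
      funext d
      by_cases hlast : a + 1 = C.wd σ
      · have hfin : C.fin σ (C.pr l) =
            ((C.cnt σ (C.pr l)).testBit a && carryBit (C.cnt σ (C.pr l)) a) := by
          rw [fin_eq_carryBit hP hw, ← hlast, carryBit_add_one]
        cases d <;>
          simp [strip, Soft.label, back, low, hl1, hpr, hs, hph, hph1, ha0, hlast, hout,
            testBit_add_one, hfin]
      · have hlt : a + 1 < C.wd σ := by omega
        cases d <;>
          simp [strip, Soft.label, back, low, hl1, hpr, hs, hph, hph1, ha0, hlast, hlt,
            testBit_add_one, carryBit_add_one]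
  · have hpr : C.pr (l + 1) = C.pr l + 1 := by unfold pr ph at *; omega
    have hph1 : C.ph (l + 1) = 0 := by unfold ph at *; omega
    have hnorth : C.strip σ a l .north = if C.fin σ (C.pr l) then
        (if a = 0 then some (.enter (C.entry σ (C.pr l))) else none) else
        if a = 0 then some (.start σ.isSome (C.entry σ (C.pr l))
          ((C.cnt σ (C.pr l) + 1).testBit 0)) else
        some (.bit σ.isSome ((C.cnt σ (C.pr l) + 1).testBit a) (decide (a + 1 = C.wd σ))) := by
      by_cases hf : C.pr l + 1 ∈ C.hp σ
      · have hnx := nx_of_mem hP hf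
        -- The pair `P` consists of the lines 2P - n % 2 and 2P + 1 - n % 2, so the location
        -- remembered by the counter is the one directly ahead.
        have hline : 2 * (C.pr l + 1) - C.n % 2 = l + 1 := by unfold pr ph at *; omega
        by_cases ha0 : a = 0 <;> simp [strip, back, fin, hf, hl1, hpr, entry, hnx, hline, ha0]
      · have hc := cnt_add_one hP hw hf
        have he : C.entry σ (C.pr l + 1) = C.entry σ (C.pr l) := by
          unfold entry; rw [nx_add_one hf]
        by_cases ha0 : a = 0 <;> simp [strip, back, fin, hf, hl1, hpr, hc, he, hph1, ha0]
    by_cases hlast : a + 1 = C.wd σ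
    · have ha0 : ¬ a = 0 := by omega
      refine ⟨.turn ((C.cnt σ (C.pr l) + 1).testBit a) (C.fin σ (C.pr l)), ?_, by simp [Soft.target]⟩
      funext d
      cases d
      · rw [hnorth]
        simp [Soft.label, ha0, hlast]
      all_goals simp [strip, Soft.label, back, low, hs, hph, ha0, hlast, hout]
    · have hlt : a + 1 < C.wd σ := by omega
      by_cases ha0 : a = 0
      · subst ha0
        refine ⟨.home (C.entry σ (C.pr l)) ((C.cnt σ (C.pr l) + 1).testBit 0)
          (C.fin σ (C.pr l)), ?_, by simp [Soft.target]⟩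
        funext d
        cases d
        · rw [hnorth]
          simp [Soft.label]
        all_goals simp_all [strip, Soft.label, back, low]
      · refine ⟨.copy ((C.cnt σ (C.pr l) + 1).testBit a) (C.fin σ (C.pr l)), ?_, by simp [Soft.target]⟩
        funext d
        cases d
        · rw [hnorth]
          simp [Soft.label, ha0, hlast]
        all_goals simp [strip, Soft.label, back, low, hs, hph, ha0, hlast, hlt]

/-! ### Coordinates, regions and the order of assembly -/

variable (C)

/-- The labels of the tile that fills the part outside the spine and the teeth. -/
def fillLabel : Dir → Option CombLabel
  | .north => some (.fill true)
  | .south => some (.fill true)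
  | .east => some (.fill false)
  | .west => some (.fill false)

/-- The labels of the tile at a location. -/
noncomputable def label (p : Point) (d : Dir) : Option CombLabel :=
  if p.1 < C.h then C.strip none p.1.toNat p.2.toNat d
  else if C.st p.2.toNat ∈ C.teeth then
    C.strip (some (C.st p.2.toNat)) (p.2.toNat - C.st p.2.toNat) p.1.toNat (Dir.tr true d)
  else fillLabel d

/-- The order of assembly inside a strip. -/
noncomputable def stripRank (σ : Option ℕ) (a l : ℕ) : ℕ :=
  l * (C.n + 1) + if C.pr l ∉ C.hp σ ∧ C.ph l ≠ 0 then C.wd σ - a else a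

/-- An order of assembly. -/
noncomputable def rank (p : Point) : ℕ :=
  if p.1 < C.h then C.stripRank none p.1.toNat p.2.toNat
  else if C.st p.2.toNat ∈ C.teeth then
    (C.n + 1) ^ 2 + C.stripRank (some (C.st p.2.toNat)) (p.2.toNat - C.st p.2.toNat) p.1.toNat
  else 2 * (C.n + 1) ^ 2 + p.1.toNat + p.2.toNat

/-- The square. -/
def region : Finset Point :=
  (Finset.range C.n ×ˢ Finset.range C.n).image fun q => ((q.1 : ℤ), (q.2 : ℤ))

variable {C}

theorem mem_region {p : Point} :
    p ∈ C.region ↔ ∃ x y : ℕ, x < C.n ∧ y < C.n ∧ p = ((x : ℤ), (y : ℤ)) := by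
  simp only [region, Finset.mem_image, Finset.mem_product, Finset.mem_range, Prod.exists]
  constructor
  · rintro ⟨x, y, ⟨hx, hy⟩, rfl⟩
    exact ⟨x, y, hx, hy, rfl⟩
  · rintro ⟨x, y, hx, hy, rfl⟩
    exact ⟨x, y, ⟨hx, hy⟩, rfl⟩

theorem mk_mem_region {x y : ℕ} : ((x : ℤ), (y : ℤ)) ∈ C.region ↔ x < C.n ∧ y < C.n := by
  rw [mem_region]
  constructor
  · rintro ⟨x', y', hx, hy, h⟩
    simp only [Prod.mk.injEq, Nat.cast_inj] at h
    rw [h.1, h.2]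
    exact ⟨hx, hy⟩
  · rintro ⟨hx, hy⟩
    exact ⟨x, y, hx, hy, rfl⟩

theorem Valid.st_add {s a l : ℕ} (h : C.Valid (some s) a l) :
    C.st (s + a) = s ∧ s + a < C.n := by
  have hs := h.mem_teeth s rfl
  have h1 := C.teeth_lt s hs
  have h2 := C.teeth_st s hs
  have h3 := h.lt_wd
  have h4 := C.en_le s h1
  have h5 := C.st_eq s h1 (s + a)
  rw [h2] at h4 h5
  simp only [wd] at h3
  exact ⟨h5 (by omega) (by omega), by omega⟩

theorem place_mem {σ : Option ℕ} {a l : ℕ} (h : C.Valid σ a l) : place σ a l ∈ C.region := by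
  cases σ with
  | none => exact mk_mem_region.2 ⟨h.lt_wd.trans_le C.h_le, h.lt_n⟩
  | some s =>
    have := mk_mem_region.2 ⟨h.lt_n, h.st_add.2⟩
    simpa [place] using this

theorem label_place {σ : Option ℕ} {a l : ℕ} (h : C.Valid σ a l) (d : Dir) :
    C.label (place σ a l) d = C.strip σ a l (Dir.tr σ.isSome d) := by
  cases σ with
  | none =>
    have : a < C.h := h.lt_wd
    simp [label, place, this, Dir.tr]
  | some s =>
    have h1 : ¬ l < C.h := not_lt.2 h.first_le
    have h2 : ((s : ℤ) + (a : ℤ)).toNat = s + a := by omega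
    have h3 := h.mem_teeth s rfl
    simp [label, place, h1, h2, h.st_add.1, h3]

theorem rank_place {σ : Option ℕ} {a l : ℕ} (h : C.Valid σ a l) :
    C.rank (place σ a l) = (if σ.isSome then (C.n + 1) ^ 2 else 0) + C.stripRank σ a l := by
  cases σ with
  | none =>
    have : a < C.h := h.lt_wd
    simp [rank, place, this]
  | some s =>
    have h1 : ¬ l < C.h := not_lt.2 h.first_le
    have h2 : ((s : ℤ) + (a : ℤ)).toNat = s + a := by omega
    have h3 := h.mem_teeth s rfl
    simp [rank, place, h1, h2, h.st_add.1, h3]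

/-- Each line has its own block of n + 1 ranks. With `rank_place_lt`, this puts the spine before the
teeth and the teeth before the filling. -/
theorem stripRank_lt {σ : Option ℕ} {a l : ℕ} (h : C.Valid σ a l) :
    C.stripRank σ a l < (l + 1) * (C.n + 1) := by
  have h1 := h.lt_wd
  have h2 := h.wd_le
  have h3 : (l + 1) * (C.n + 1) = l * (C.n + 1) + (C.n + 1) := by ring
  unfold stripRank
  split_ifs <;> omega

theorem rank_place_lt {σ : Option ℕ} {a l : ℕ} (h : C.Valid σ a l) :
    C.rank (place σ a l) < (if σ.isSome then 2 else 1) * (C.n + 1) ^ 2 := by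
  have h1 := stripRank_lt h
  have h2 : (l + 1) * (C.n + 1) ≤ (C.n + 1) ^ 2 := by
    rw [sq]
    exact Nat.mul_le_mul_right _ (by have := h.lt_n; omega)
  rw [rank_place h]
  split_ifs <;> omega

/-- The locations outside the spine and the teeth. -/
structure IsFill (C : Comb) (x y : ℕ) : Prop where
  le : C.h ≤ x
  lt_x : x < C.n
  lt_y : y < C.n
  notMem : C.st y ∉ C.teeth

theorem exists_valid_or_isFill {p : Point} (hp : p ∈ C.region) :
    (∃ σ a l, C.Valid σ a l ∧ p = place σ a l) ∨
      ∃ x y : ℕ, C.IsFill x y ∧ p = ((x : ℤ), (y : ℤ)) := by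
  obtain ⟨x, y, hx, hy, rfl⟩ := mem_region.1 hp
  by_cases h1 : x < C.h
  · exact Or.inl ⟨none, x, y, ⟨by simp, h1, Nat.zero_le _, hy⟩, rfl⟩
  · by_cases h2 : C.st y ∈ C.teeth
    · have h3 := C.lt_en y hy
      have h4 := C.st_le y
      refine Or.inl ⟨some (C.st y), y - C.st y, x, ⟨by simpa using h2, ?_, not_lt.1 h1, hx⟩, ?_⟩
      · simp only [wd]; omega
      · simp only [place, Prod.mk.injEq, true_and]; omega
    · exact Or.inr ⟨x, y, ⟨not_lt.1 h1, hx, hy, h2⟩, rfl⟩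

theorem IsFill.label_eq {x y : ℕ} (h : C.IsFill x y) :
    C.label ((x : ℤ), (y : ℤ)) = fillLabel := by
  funext d
  have h1 := not_lt.2 h.le
  simp [label, h1, h.notMem]

theorem IsFill.rank_eq {x y : ℕ} (h : C.IsFill x y) :
    C.rank ((x : ℤ), (y : ℤ)) = 2 * (C.n + 1) ^ 2 + x + y := by
  have h1 := not_lt.2 h.le
  simp [rank, h1, h.notMem]

/-! ### Neighbours in a strip -/

theorem place_add_fwd (σ : Option ℕ) (a l : ℕ) :
    place σ a l + (Dir.tr σ.isSome .north).vec = place σ a (l + 1) := by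
  cases σ <;> simp [place, Dir.tr, Dir.vec]

theorem place_add_back (σ : Option ℕ) (a l : ℕ) :
    place σ a (l + 1) + (Dir.tr σ.isSome .south).vec = place σ a l := by
  cases σ <;> simp [place, Dir.tr, Dir.vec]

theorem place_add_high (σ : Option ℕ) (a l : ℕ) :
    place σ a l + (Dir.tr σ.isSome .east).vec = place σ (a + 1) l := by
  cases σ <;> simp [place, Dir.tr, Dir.vec, add_assoc]

theorem place_add_low (σ : Option ℕ) (a l : ℕ) :
    place σ (a + 1) l + (Dir.tr σ.isSome .west).vec = place σ a l := by
  cases σ <;> simp [place, Dir.tr, Dir.vec, add_assoc]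

theorem Valid.of_line {σ : Option ℕ} {a l l' : ℕ} (h : C.Valid σ a l) (h1 : C.first σ ≤ l')
    (h2 : l' < C.n) : C.Valid σ a l' := ⟨h.mem_teeth, h.lt_wd, h1, h2⟩

theorem Valid.of_pos {σ : Option ℕ} {a a' l : ℕ} (h : C.Valid σ a l) (h1 : a' < C.wd σ) :
    C.Valid σ a' l := ⟨h.mem_teeth, h1, h.first_le, h.lt_n⟩

/-! ### The flow of the labels -/

theorem inn_of_back {σ : Option ℕ} {a l : ℕ} {b : CombLabel} (h : C.back σ a l = some b)
    (d : Dir) : b.inn d ↔ d.isLow = true := by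
  unfold back at h
  split_ifs at h <;> cases h <;> rfl

theorem inn_of_out {σ : Option ℕ} {l : ℕ} {b : CombLabel} (h : C.out σ l = some b)
    (d : Dir) : b.inn d ↔ d.isLow = true := by
  unfold out at h
  split_ifs at h <;> cases h <;> rfl

/-- Along a line information runs from the low to the high end, except in the second line of a
counter pair. -/
theorem inn_of_low {σ : Option ℕ} {a l : ℕ} {b : CombLabel} (h : C.low σ a l = some b)
    (d : Dir) : b.inn d ↔ (d.isLow = true ↔ ¬ (C.pr l ∉ C.hp σ ∧ C.ph l ≠ 0)) := by
  unfold low at h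
  split_ifs at h with h1 h2 h3 <;> cases h <;> simp [CombLabel.inn, h2]
  · simp [h3]
  · simp [h3]

theorem back_ne_fill {σ : Option ℕ} {a l : ℕ} {o : Bool} : C.back σ a l ≠ some (.fill o) := by
  unfold back
  split_ifs <;> simp

theorem low_ne_fill {σ : Option ℕ} {a l : ℕ} {o : Bool} : C.low σ a l ≠ some (.fill o) := by
  unfold low
  split_ifs <;> simp

theorem ne_zero_of_low {σ : Option ℕ} {a l : ℕ} {b : CombLabel} (h : C.low σ a l = some b) :
    a ≠ 0 := by
  rintro rfl
  simp [low] at h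

/-- The entrance of a tooth. -/
theorem place_none_add_east {s : ℕ} :
    place none (C.h - 1) s + Dir.east.vec = place (some s) 0 C.h := by
  have := C.two_le
  simp only [place, Dir.vec, Prod.mk_add_mk, Prod.mk.injEq]
  omega

theorem valid_entrance {s : ℕ} (hs : s ∈ C.teeth) (h : C.h < C.n) : C.Valid (some s) 0 C.h := by
  refine ⟨by simpa using hs, ?_, le_rfl, h⟩
  have := C.height s (C.teeth_lt s hs)
  rw [C.teeth_st s hs] at this
  have := C.two_le
  simp only [wd]
  omega

theorem valid_exit {s : ℕ} (hs : s ∈ C.teeth) : C.Valid none (C.h - 1) s :=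
  ⟨by simp, by have := C.two_le; simp only [wd]; omega, Nat.zero_le _, C.teeth_lt s hs⟩

theorem back_entrance (s : ℕ) :
    C.back (some s) 0 C.h = some (.enter (place (some s) 0 C.h)) := by
  have : C.pr C.h ∈ C.hp (some s) := pr_first_mem (some s)
  simp [back, this]

/-- The inputs of the tiles of a strip are supplied. -/
theorem supplied_strip {σ : Option ℕ} {a l : ℕ} (hv : C.Valid σ a l) (d : Dir) {b : CombLabel}
    (hb : C.strip σ a l d = some b) (hin : b.inn d) :
    place σ a l + (Dir.tr σ.isSome d).vec ∈ C.region ∧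
      C.label (place σ a l + (Dir.tr σ.isSome d).vec) (Dir.tr σ.isSome d).opp = some b ∧
      C.rank (place σ a l + (Dir.tr σ.isSome d).vec) < C.rank (place σ a l) := by
  cases d with
  | north =>
    simp only [strip] at hb
    split_ifs at hb with h1
    exact absurd ((inn_of_back hb _).1 hin) (by simp [Dir.isLow])
  | south =>
    simp only [strip] at hb
    -- The first line of a tooth is entered from the spine. The first line of the spine has no input
    -- from behind.
    by_cases hl : l = C.first σ
    · have hhard : C.pr l ∈ C.hp σ := hl ▸ pr_first_mem σ
      rw [back, if_pos hhard] at hb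
      split_ifs at hb with h0
      obtain ⟨rfl, h0⟩ := h0
      cases σ with
      | none => exact absurd hl (h0 rfl)
      | some s =>
        simp only [first] at hl
        subst hl
        have hs := hv.mem_teeth s rfl
        have hn : C.h < C.n := hv.lt_n
        have hx := valid_exit hs
        have hpl : place (some s) 0 C.h + (Dir.tr (some s).isSome .south).vec =
            place none (C.h - 1) s := by
          rw [← place_none_add_east]
          exact Dir.add_vec_add_opp_vec _ Dir.east
        rw [hpl]
        refine ⟨place_mem hx, ?_, ?_⟩
        · rw [label_place hx]
          have : ¬ C.h - 1 + 1 < C.h := by omega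
          simp only [Option.isSome, Dir.tr, Dir.opp, strip, wd, this, if_false, out, hs, hn,
            and_self, if_true]
          exact hb
        · have h1 := rank_place_lt hx
          rw [rank_place hv]
          simp only [Option.isSome, if_true] at h1 ⊢
          simp only [Bool.false_eq_true, if_false, one_mul] at h1
          omega
    · have hl1 := hv.first_le
      obtain ⟨l, rfl⟩ : ∃ k, l = k + 1 := ⟨l - 1, by omega⟩
      have hn := hv.lt_n
      have hv' := hv.of_line (l' := l) (by omega) (by omega)
      rw [place_add_back]
      refine ⟨place_mem hv', ?_, ?_⟩
      · rw [label_place hv', Dir.opp_tr, Dir.tr_tr]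
        simpa [Dir.opp, strip, hn] using hb
      · rw [rank_place hv', rank_place hv]
        have h1 := stripRank_lt hv'
        have h2 : (l + 1) * (C.n + 1) ≤ C.stripRank σ a (l + 1) := Nat.le_add_right _ _
        omega
  | west =>
    simp only [strip] at hb
    have ha := ne_zero_of_low hb
    obtain ⟨a, rfl⟩ : ∃ k, a = k + 1 := ⟨a - 1, by omega⟩
    have hw := hv.lt_wd
    have hv' := hv.of_pos (a' := a) (by omega)
    rw [place_add_low]
    refine ⟨place_mem hv', ?_, ?_⟩
    · rw [label_place hv', Dir.opp_tr, Dir.tr_tr]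
      simpa [Dir.opp, strip, hw] using hb
    · rw [rank_place hv', rank_place hv]
      have := ((inn_of_low hb _).1 hin).1 rfl
      simp [stripRank, this]
  | east =>
    simp only [strip] at hb
    split_ifs at hb with hw
    · have hv' := hv.of_pos hw
      rw [place_add_high]
      refine ⟨place_mem hv', ?_, ?_⟩
      · rw [label_place hv', Dir.opp_tr, Dir.tr_tr]
        simpa [Dir.opp, strip] using hb
      · rw [rank_place hv', rank_place hv]
        have h2 := (inn_of_low hb Dir.east).1 hin
        simp only [Dir.isLow, Bool.false_eq_true, false_iff, not_not] at h2
        simp only [stripRank, h2, not_false_eq_true, ne_eq, and_self, if_true]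
        omega
    · exact absurd ((inn_of_out hb _).1 hin) (by simp [Dir.isLow])

/-- The outputs of the tiles of a strip other than fill labels are inputs of the neighbours. -/
theorem received_strip {σ : Option ℕ} {a l : ℕ} (hv : C.Valid σ a l) (d : Dir) {b : CombLabel}
    (hb : C.strip σ a l d = some b) (hout : ¬ b.inn d) (hf : ∀ o, b ≠ .fill o) :
    place σ a l + (Dir.tr σ.isSome d).vec ∈ C.region ∧
      C.label (place σ a l + (Dir.tr σ.isSome d).vec) (Dir.tr σ.isSome d).opp = some b := by
  cases d with
  | north =>
    simp only [strip] at hb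
    split_ifs at hb with hl
    have hv' := hv.of_line (hv.first_le.trans (Nat.le_succ l)) hl
    rw [place_add_fwd]
    refine ⟨place_mem hv', ?_⟩
    rw [label_place hv', Dir.opp_tr, Dir.tr_tr]
    exact hb
  | south => exact absurd ((inn_of_back hb _).2 rfl) hout
  | west =>
    simp only [strip] at hb
    have ha := ne_zero_of_low hb
    obtain ⟨a, rfl⟩ : ∃ k, a = k + 1 := ⟨a - 1, by omega⟩
    have hw := hv.lt_wd
    have hv' := hv.of_pos (a' := a) (by omega)
    rw [place_add_low]
    refine ⟨place_mem hv', ?_⟩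
    rw [label_place hv', Dir.opp_tr, Dir.tr_tr]
    simpa [Dir.opp, strip, hw] using hb
  | east =>
    simp only [strip] at hb
    split_ifs at hb with hw
    · have hv' := hv.of_pos hw
      rw [place_add_high]
      refine ⟨place_mem hv', ?_⟩
      rw [label_place hv', Dir.opp_tr, Dir.tr_tr]
      simpa [Dir.opp, strip] using hb
    · unfold out at hb
      split_ifs at hb with h1
      · obtain ⟨rfl, hs, hn⟩ := h1
        have hx := valid_entrance hs hn
        have ha : a = C.h - 1 := by
          have := hv.lt_wd
          simp only [wd] at this hw
          omega
        subst ha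
        change place none (C.h - 1) l + Dir.east.vec ∈ _ ∧
          C.label (place none (C.h - 1) l + Dir.east.vec) Dir.west = _
        rw [place_none_add_east]
        refine ⟨place_mem hx, ?_⟩
        rw [label_place hx]
        exact (back_entrance l).trans hb
      · exact absurd (Option.some.inj hb).symm (hf _)

/-- The lowest slab is always a tooth, so every filling tile has a neighbour to its south from which
to take an input. -/
theorem IsFill.pos {x y : ℕ} (h : C.IsFill x y) : 0 < y := by
  rcases Nat.eq_zero_or_pos y with rfl | hy
  · have := C.st_le 0
    exact absurd (by rw [Nat.le_zero.1 this]; exact C.zero_mem) h.notMem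
  · exact hy

/-- The row above a row belongs to the same slab or starts a new one. -/
theorem st_add_one {y : ℕ} (h : y + 1 < C.n) :
    C.st (y + 1) = C.st y ∨ (C.st (y + 1) = y + 1 ∧ C.en (C.st y) = y + 1) := by
  have h1 := C.lt_en y (by omega)
  have h2 := C.st_le y
  by_cases h3 : y + 1 < C.en (C.st y)
  · exact Or.inl (C.st_eq y (by omega) _ (by omega) h3)
  · have h4 : C.en (C.st y) = y + 1 := by omega
    have h5 := C.st_en y (by omega)
    rw [h4] at h5
    exact Or.inr ⟨h5 h, h4⟩

/-- Below a filling tile lies another one or the high end of a tooth, since slabs are filled or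
toothed as a whole. -/
theorem label_north_below_isFill {x y : ℕ} (h : C.IsFill x (y + 1)) :
    C.label ((x : ℤ), (y : ℤ)) .north = some (.fill true) := by
  have hy := h.lt_y
  rcases exists_valid_or_isFill (mk_mem_region.2 ⟨h.lt_x, by omega⟩ :
    ((x : ℤ), (y : ℤ)) ∈ C.region) with ⟨σ, a, l, hv, hp⟩ | ⟨x', y', h', hp⟩
  · rw [hp, label_place hv]
    have hx := h.le
    cases σ with
    | none =>
      have := hv.lt_wd
      simp only [place, Prod.mk.injEq, Nat.cast_inj, wd] at hp this
      omega
    | some s =>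
      have hst := hv.st_add
      have hs := hv.mem_teeth s rfl
      simp only [place, Prod.mk.injEq, Nat.cast_inj] at hp
      have hy' : y = s + a := by omega
      have hw : ¬ a + 1 < C.wd (some s) := by
        rw [← hy'] at hst
        rcases st_add_one hy with h1 | ⟨h1, h2⟩
        · exact absurd (by rw [h1, hst.1]; exact hs) h.notMem
        · rw [hst.1] at h2
          simp only [wd]
          omega
      simp [Dir.tr, strip, hw, out]
  · rw [hp, h'.label_eq]
    rfl

theorem label_east_of_isFill {x y : ℕ} (h : C.IsFill (x + 1) y) :
    C.label ((x : ℤ), (y : ℤ)) .east = some (.fill false) := by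
  have hx := h.lt_x
  by_cases h1 : x < C.h
  · have hv : C.Valid none x y := ⟨by simp, h1, Nat.zero_le _, h.lt_y⟩
    have hx' : ¬ x + 1 < C.wd none := not_lt.2 h.le
    have hy : y ∉ C.teeth := fun hy => h.notMem (by rw [C.teeth_st y hy]; exact hy)
    change C.label (place none x y) .east = _
    rw [label_place hv]
    simp [Dir.tr, strip, hx', out, hy]
  · have : C.IsFill x y := ⟨not_lt.1 h1, by omega, h.lt_y, h.notMem⟩
    rw [this.label_eq]
    rfl

theorem supplied (p : Point) (hp : p ∈ C.region) (d : Dir) (b : CombLabel)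
    (hb : C.label p d = some b) (hin : b.inn d) :
    p + d.vec ∈ C.region ∧ C.label (p + d.vec) d.opp = some b ∧ C.rank (p + d.vec) < C.rank p := by
  rcases exists_valid_or_isFill hp with ⟨σ, a, l, hv, rfl⟩ | ⟨x, y, h, rfl⟩
  · rw [label_place hv] at hb
    have := supplied_strip hv (Dir.tr σ.isSome d) hb (by simpa using hin)
    rwa [Dir.tr_tr] at this
  · have hrank : ∀ q : Point, q ∈ C.region → (∀ x' y' : ℕ, q = ((x' : ℤ), (y' : ℤ)) →
        x' + y' < x + y) → C.rank q < C.rank ((x : ℤ), (y : ℤ)) := by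
      intro q hq hxy
      rw [h.rank_eq]
      rcases exists_valid_or_isFill hq with ⟨σ, a, l, hv, rfl⟩ | ⟨x', y', h', rfl⟩
      · have := rank_place_lt hv
        have h2 : (if σ.isSome then 2 else 1) * (C.n + 1) ^ 2 ≤ 2 * (C.n + 1) ^ 2 :=
          Nat.mul_le_mul_right _ (by split_ifs <;> omega)
        omega
      · have := hxy x' y' rfl
        rw [h'.rank_eq]
        omega
    rw [h.label_eq] at hb
    have hlx := h.lt_x
    have hly := h.lt_y
    cases d with
    | north => cases hb; simp [CombLabel.inn, Dir.isLow] at hin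
    | east => cases hb; simp [CombLabel.inn, Dir.isLow] at hin
    | south =>
      cases hb
      obtain ⟨y, rfl⟩ : ∃ k, y = k + 1 := ⟨y - 1, by have := h.pos; omega⟩
      have hq : (((x : ℤ), ((y + 1 : ℕ) : ℤ)) : Point) + Dir.south.vec = ((x : ℤ), (y : ℤ)) := by
        simp [Dir.vec]
      have hqm : ((x : ℤ), (y : ℤ)) ∈ C.region := mk_mem_region.2 ⟨hlx, by omega⟩
      rw [hq]
      refine ⟨hqm, label_north_below_isFill h, hrank _ hqm ?_⟩
      rintro x' y' hxy
      simp only [Prod.mk.injEq, Nat.cast_inj] at hxy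
      omega
    | west =>
      cases hb
      obtain ⟨x, rfl⟩ : ∃ k, x = k + 1 :=
        ⟨x - 1, by have := h.le; have := C.two_le; omega⟩
      have hq : ((((x + 1 : ℕ) : ℤ), (y : ℤ)) : Point) + Dir.west.vec = ((x : ℤ), (y : ℤ)) := by
        simp [Dir.vec]
      have hqm : ((x : ℤ), (y : ℤ)) ∈ C.region := mk_mem_region.2 ⟨by omega, hly⟩
      rw [hq]
      refine ⟨hqm, label_east_of_isFill h, hrank _ hqm ?_⟩
      rintro x' y' hxy
      simp only [Prod.mk.injEq, Nat.cast_inj] at hxy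
      omega

/-- Fill labels have to be excepted: they are also offered to the low side of a tooth, which has no
glue, and across the border of the square. -/
theorem received (q : Point) (hq : q ∈ C.region) (d : Dir) (b : CombLabel)
    (hb : C.label q d = some b) (hout : ¬ b.inn d) (hf : ∀ o, b ≠ .fill o) :
    q + d.vec ∈ C.region ∧ C.label (q + d.vec) d.opp = some b := by
  rcases exists_valid_or_isFill hq with ⟨σ, a, l, hv, rfl⟩ | ⟨x, y, h, rfl⟩
  · rw [label_place hv] at hb
    have := received_strip hv (Dir.tr σ.isSome d) hb (by simpa using hout) hf
    rwa [Dir.tr_tr] at this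
  · rw [h.label_eq] at hb
    cases d <;> cases hb <;> exact absurd rfl (hf _)

/-! ### The inputs determine the tile -/

variable (C) in
/-- The hard-coded locations. -/
def IsHard (p : Point) : Prop := ∃ σ a l, C.Valid σ a l ∧ C.pr l ∈ C.hp σ ∧ p = place σ a l

/-- A hard-coded tile has at most one input, which is specific to its location. -/
theorem IsHard.input {p : Point} (hp : C.IsHard p) : ∃ d₀ : Dir, ∀ d b, C.label p d = some b →
    b.inn d → d = d₀ ∧ b = .enter p := by
  obtain ⟨σ, a, l, hv, hh, rfl⟩ := hp
  have key : ∀ d b, C.strip σ a l d = some b → b.inn d →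
      d = (if a = 0 then .south else .west) ∧ b = .enter (place σ a l) := by
    intro d b hb hin
    cases d with
    | north =>
      simp only [strip] at hb
      split_ifs at hb
      exact absurd ((inn_of_back hb _).1 hin) (by simp [Dir.isLow])
    | south =>
      simp only [strip, back, if_pos hh] at hb
      split_ifs at hb with h
      cases hb
      exact ⟨by simp [h.1], rfl⟩
    | west =>
      simp only [strip, low, if_pos hh] at hb
      split_ifs at hb with h
      cases hb
      exact ⟨by simp [h], rfl⟩
    | east =>
      simp only [strip] at hb
      split_ifs at hb
      · have := (inn_of_low hb _).1 hin
        simp [Dir.isLow, hh] at this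
      · exact absurd ((inn_of_out hb _).1 hin) (by simp [Dir.isLow])
  refine ⟨Dir.tr σ.isSome (if a = 0 then .south else .west), fun d b hb hin => ?_⟩
  rw [label_place hv] at hb
  obtain ⟨h1, h2⟩ := key _ b hb (by simpa using hin)
  exact ⟨by rw [← h1, Dir.tr_tr], h2⟩

theorem IsHard.exists_input {p : Point} (hp : C.IsHard p) (h0 : p ≠ (0, 0)) :
    ∃ d, C.label p d = some (.enter p) ∧ (CombLabel.enter p).inn d := by
  obtain ⟨σ, a, l, hv, hh, rfl⟩ := hp
  refine ⟨Dir.tr σ.isSome (if a = 0 then .south else .west), ?_, ?_⟩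
  · rw [label_place hv, Dir.tr_tr]
    by_cases ha : a = 0
    · subst ha
      have : σ = none → l ≠ 0 := by
        rintro rfl rfl
        simp [place] at h0
      simp only [if_true, strip, back, if_pos hh]
      rw [if_pos ⟨trivial, this⟩]
    · simp [ha, strip, low, hh]
  · rw [CombLabel.inn_tr]
    split_ifs <;> simp [CombLabel.inn, Dir.isLow]

/-- Needed for the count: the locations remembered by counter tiles range over hard-coded locations
only. -/
theorem isHard_entry {σ : Option ℕ} {a l : ℕ} (hv : C.Valid σ a l) (hs : C.pr l ∉ C.hp σ) :
    C.IsHard (C.entry σ (C.pr l)) := by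
  have hP := lt_pr_last hv.lt_n hs
  obtain ⟨h1, h2⟩ := nx_spec (σ := σ) hP
  have h3 := nx_le (pr_last_mem σ) hP
  have h4 := hv.first_le
  have h5 := hv.lt_n
  have h6 := hv.lt_wd
  refine ⟨σ, 0, _, ⟨hv.mem_teeth, by omega, ?_, ?_⟩, ?_, rfl⟩
  · unfold pr at *; omega
  · unfold pr at *; omega
  · have : C.pr (2 * C.nx σ (C.pr l) - C.n % 2) = C.nx σ (C.pr l) := by unfold pr at *; omega
    rw [this]
    exact h1

/-- The three kinds of tiles. -/
theorem cases_of_mem' {p : Point} (hp : p ∈ C.region) : C.IsHard p ∨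
    (∃ (o : Bool) (s : Soft), (∀ d, C.label p d = s.label o (Dir.tr o d)) ∧
      ∀ q ∈ s.target, C.IsHard q) ∨
    ∃ x y : ℕ, C.IsFill x y ∧ p = ((x : ℤ), (y : ℤ)) := by
  rcases exists_valid_or_isFill hp with ⟨σ, a, l, hv, rfl⟩ | h
  · by_cases hh : C.pr l ∈ C.hp σ
    · exact Or.inl ⟨σ, a, l, hv, hh, rfl⟩
    · obtain ⟨s, hs, ht⟩ := exists_soft hv hh
      refine Or.inr (Or.inl ⟨σ.isSome, s, fun d => by rw [label_place hv, hs], fun q hq => ?_⟩)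
      rw [ht q hq]
      exact isHard_entry hv hh
  · exact Or.inr (Or.inr h)

theorem cases_of_mem {p : Point} (hp : p ∈ C.region) : C.IsHard p ∨
    (∃ (o : Bool) (s : Soft), ∀ d, C.label p d = s.label o (Dir.tr o d)) ∨
    ∃ x y : ℕ, C.IsFill x y ∧ p = ((x : ℤ), (y : ℤ)) := by
  rcases cases_of_mem' hp with h | ⟨o, s, h, -⟩ | h
  · exact Or.inl h
  · exact Or.inr (Or.inl ⟨o, s, h⟩)
  · exact Or.inr (Or.inr h)

theorem eq_of_label_eq_enter {p q : Point} (hp : p ∈ C.region) {d : Dir}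
    (h : C.label p d = some (.enter q)) (hin : (CombLabel.enter q).inn d) : p = q := by
  rcases cases_of_mem hp with hh | ⟨o, s, hs⟩ | ⟨x, y, hf, rfl⟩
  · obtain ⟨d₀, h₀⟩ := hh.input
    cases (h₀ d _ h hin).2
    rfl
  · rw [hs] at h
    have h1 := Soft.input_iff.1 ⟨h, (CombLabel.inn_tr _ o d).2 hin⟩
    generalize Dir.tr o d = d' at h1
    cases h1
  · rw [hf.label_eq] at h
    cases d <;> cases h

theorem exists_isFill_of_label {p : Point} (hp : p ∈ C.region) {d : Dir} {o : Bool}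
    (h : C.label p d = some (.fill o)) (hin : (CombLabel.fill o).inn d) :
    ∃ x y : ℕ, C.IsFill x y ∧ p = ((x : ℤ), (y : ℤ)) := by
  rcases cases_of_mem hp with hh | ⟨o', s, hs⟩ | hf
  · obtain ⟨d₀, h₀⟩ := hh.input
    cases (h₀ d _ h hin).2
  · rw [hs] at h
    have h1 := Soft.input_iff.1 ⟨h, (CombLabel.inn_tr _ o' d).2 hin⟩
    generalize Dir.tr o' d = d' at h1
    cases h1
  · exact hf

theorem label_eq_of_soft {p q : Point} {o o' : Bool} {s s' : Soft}
    (hp : ∀ d, C.label p d = s.label o (Dir.tr o d))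
    (hq : ∀ d, C.label q d = s'.label o' (Dir.tr o' d)) (h : o = o' ∧ s = s') :
    C.label p = C.label q := by
  funext d
  rw [hp, hq, h.1, h.2]

/-- Labels of strength 2 either name their target or determine a counter tile; fill labels have
strength 1. -/
theorem determined_one (p r : Point) (hp : p ∈ C.region) (hr : r ∈ C.region) {d : Dir}
    {b : CombLabel} (h : C.label r d = some b) (h' : C.label p d = some b) (hin : b.inn d)
    (h2 : b.two = true) : C.label p = C.label r := by
  rcases cases_of_mem hp with hh | ⟨o, s, hs⟩ | ⟨x, y, hf, rfl⟩
  · obtain ⟨d₀, h₀⟩ := hh.input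
    cases (h₀ d _ h' hin).2
    rw [eq_of_label_eq_enter hr h hin]
  · rcases cases_of_mem hr with hh | ⟨o', s', hs'⟩ | ⟨x, y, hf, rfl⟩
    · obtain ⟨d₀, h₀⟩ := hh.input
      cases (h₀ d _ h hin).2
      rw [eq_of_label_eq_enter hp h' hin]
    · refine label_eq_of_soft hs hs' ?_
      rw [hs] at h'
      rw [hs'] at h
      exact (Soft.input_iff.1 ⟨h', (CombLabel.inn_tr _ o d).2 hin⟩).eq_of_two
        (Soft.input_iff.1 ⟨h, (CombLabel.inn_tr _ o' d).2 hin⟩) h2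
    · rw [hf.label_eq] at h
      cases d <;> cases h <;> cases h2
  · rw [hf.label_eq] at h'
    cases d <;> cases h' <;> cases h2

/-- Hard-coded tiles are excluded because they have at most one input. Counter tiles are settled by
`Soft.Input.eq_of_ne`, and a fill label is an input of filling tiles only. -/
theorem determined_two (p r : Point) (hp : p ∈ C.region) (hr : r ∈ C.region) {d e : Dir}
    {b c : CombLabel} (hde : d ≠ e)
    (h : C.label r d = some b) (h' : C.label p d = some b) (hin : b.inn d)
    (g : C.label r e = some c) (g' : C.label p e = some c) (gin : c.inn e) :
    C.label p = C.label r := by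
  rcases cases_of_mem hp with hh | ⟨o, s, hs⟩ | ⟨x, y, hf, rfl⟩
  · obtain ⟨d₀, h₀⟩ := hh.input
    exact absurd ((h₀ d _ h' hin).1.trans (h₀ e _ g' gin).1.symm) hde
  · rcases cases_of_mem hr with hh | ⟨o', s', hs'⟩ | ⟨x, y, hf, rfl⟩
    · obtain ⟨d₀, h₀⟩ := hh.input
      exact absurd ((h₀ d _ h hin).1.trans (h₀ e _ g gin).1.symm) hde
    · refine label_eq_of_soft hs hs' ?_
      rw [hs] at h' g'
      rw [hs'] at h g
      exact (Soft.input_iff.1 ⟨h', (CombLabel.inn_tr _ o d).2 hin⟩).eq_of_ne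
        (Soft.input_iff.1 ⟨g', (CombLabel.inn_tr _ o e).2 gin⟩)
        (fun hh => hde (by simpa using congrArg (Dir.tr o) hh))
        (Soft.input_iff.1 ⟨h, (CombLabel.inn_tr _ o' d).2 hin⟩)
        (Soft.input_iff.1 ⟨g, (CombLabel.inn_tr _ o' e).2 gin⟩)
    · obtain ⟨o', hb⟩ : ∃ o', b = .fill o' := by
        rw [hf.label_eq] at h
        cases d <;> cases h <;> exact ⟨_, rfl⟩
      subst hb
      obtain ⟨x', y', hf', rfl⟩ := exists_isFill_of_label hp h' hin
      rw [hf.label_eq, hf'.label_eq]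
  · obtain ⟨o', hb⟩ : ∃ o', b = .fill o' := by
      rw [hf.label_eq] at h'
      cases d <;> cases h' <;> exact ⟨_, rfl⟩
    subst hb
    obtain ⟨x', y', hf', rfl⟩ := exists_isFill_of_label hr h hin
    rw [hf.label_eq, hf'.label_eq]

/-- A location with fill labels to its south and to its west lies outside the strips. -/
theorem exists_isFill_of_neighbours {p : Point} (hs : p + Dir.south.vec ∈ C.region)
    (hs' : C.label (p + Dir.south.vec) .north = some (.fill true))
    (hw : p + Dir.west.vec ∈ C.region)
    (hw' : C.label (p + Dir.west.vec) .east = some (.fill false)) :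
    ∃ x y : ℕ, C.IsFill x y ∧ p = ((x : ℤ), (y : ℤ)) := by
  obtain ⟨x, y, hx, hy, hxy⟩ := mem_region.1 hs
  obtain ⟨x', y', hx', hy', hxy'⟩ := mem_region.1 hw
  obtain ⟨p1, p2⟩ := p
  simp only [Dir.vec, Prod.mk_add_mk, Prod.mk.injEq] at hxy hxy'
  obtain rfl : x = x' + 1 := by omega
  obtain rfl : y' = y + 1 := by omega
  refine ⟨x' + 1, y + 1, ?_, by simp only [Prod.mk.injEq]; omega⟩
  rw [show ((p1, p2) : Point) + Dir.south.vec = (((x' + 1 : ℕ) : ℤ), (y : ℤ)) by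
    simp only [Dir.vec, Prod.mk_add_mk, Prod.mk.injEq]; omega] at hs hs'
  rw [show ((p1, p2) : Point) + Dir.west.vec = ((x' : ℤ), ((y + 1 : ℕ) : ℤ)) by
    simp only [Dir.vec, Prod.mk_add_mk, Prod.mk.injEq]; omega] at hw hw'
  -- the tile to the west
  have hwest : C.IsFill x' (y + 1) ∨ (x' + 1 = C.h ∧ y + 1 ∉ C.teeth) := by
    rcases exists_valid_or_isFill hw with ⟨σ, a, l, hv, hpl⟩ | ⟨x, y', h, hpl⟩
    · rw [hpl, label_place hv] at hw'
      cases σ with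
      | none =>
        simp only [place, Prod.mk.injEq, Nat.cast_inj] at hpl
        obtain ⟨rfl, rfl⟩ := hpl
        simp only [Option.isSome, Dir.tr, strip] at hw'
        have := hv.lt_wd
        split_ifs at hw' with h1
        · exact absurd hw' low_ne_fill
        · simp only [wd] at h1 this
          have h2 : x' + 1 = C.h := by omega
          refine Or.inr ⟨h2, fun h3 => ?_⟩
          simp [out, h3, show C.h < C.n by omega] at hw'
      | some s =>
        simp only [Option.isSome, Dir.tr, strip] at hw'
        split_ifs at hw' with h1
        exact absurd hw' back_ne_fill
    · simp only [Prod.mk.injEq, Nat.cast_inj] at hpl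
      obtain ⟨rfl, rfl⟩ := hpl
      exact Or.inl h
  rcases hwest with h | ⟨h1, h2⟩
  · exact ⟨h.le.trans (Nat.le_succ _), hx, hy', h.notMem⟩
  · refine ⟨h1.ge, hx, hy', ?_⟩
    -- Next to the spine, a row inside a tooth has a tooth tile to its south that offers no fill
    -- label, and the first row of a tooth has a spine tile to its west that opens the tooth
    -- instead.
    rcases st_add_one hy' with h3 | ⟨h3, -⟩
    · rw [h3]
      -- the tile to the south
      rcases exists_valid_or_isFill hs with ⟨σ, a, l, hv, hpl⟩ | ⟨x, y', h, hpl⟩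
      · exfalso
        rw [hpl, label_place hv] at hs'
        cases σ with
        | none =>
          have := hv.lt_wd
          simp only [place, Prod.mk.injEq, Nat.cast_inj, wd] at hpl this
          omega
        | some s =>
          have hst := hv.st_add
          simp only [place, Prod.mk.injEq, Nat.cast_inj] at hpl
          obtain rfl : y = s + a := by omega
          simp only [Option.isSome, Dir.tr, strip] at hs'
          split_ifs at hs' with h4
          · exact absurd hs' low_ne_fill
          · have h5 := C.lt_en (s + a + 1) hy'
            rw [h3, hst.1] at h5
            simp only [wd] at h4
            omega
      · simp only [Prod.mk.injEq, Nat.cast_inj] at hpl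
        obtain ⟨rfl, rfl⟩ := hpl
        exact h.notMem
    · rw [h3]
      exact h2

variable (C) in
/-- The blueprint of a comb. -/
noncomputable def blueprint : Blueprint CombLabel where
  two := CombLabel.two
  inn := CombLabel.inn
  inn_opp := CombLabel.inn_opp
  region := C.region
  label := C.label
  start := (0, 0)
  start_mem := by
    have := C.two_le
    have := C.h_le
    exact mem_region.2 ⟨0, 0, by omega, by omega, rfl⟩
  rank := C.rank
  start_inputs d b hb hin := by
    have h1 := C.two_le
    have h2 := C.h_le
    have hv : C.Valid none 0 0 :=
      ⟨by simp, by simp only [wd]; omega, le_rfl, by omega⟩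
    have hh : C.pr 0 ∈ C.hp none := pr_first_mem none
    have hb' : C.label (place none 0 0) d = some b := hb
    rw [label_place hv] at hb'
    cases d with
    | north =>
      simp only [Option.isSome, Dir.tr, strip] at hb'
      split_ifs at hb'
      exact absurd ((inn_of_back hb' _).1 hin) (by simp [Dir.isLow])
    | south => simp [Dir.tr, strip, back, hh] at hb'
    | west => simp [Dir.tr, strip, low] at hb'
    | east =>
      simp only [Option.isSome, Dir.tr, strip] at hb'
      split_ifs at hb'
      · have := (inn_of_low hb' _).1 hin
        simp [Dir.isLow, hh] at this
      · exact absurd ((inn_of_out hb' _).1 hin) (by simp [Dir.isLow])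
  supplied := supplied
  inputs p hp h0 := by
    rcases cases_of_mem hp with hh | ⟨o, s, hs⟩ | ⟨x, y, hf, rfl⟩
    · obtain ⟨d, h1, h2⟩ := hh.exists_input h0
      obtain ⟨d₀, h₀⟩ := hh.input
      refine Or.inl ⟨d, _, ⟨h1, h2⟩, rfl, fun d' b' h1' h2' => ?_⟩
      rw [(h₀ d' b' h1' h2').1, (h₀ d _ h1 h2).1]
    · have key : ∀ d b, C.label p d = some b → b.inn d → s.Input o (Dir.tr o d) b :=
        fun d b h h' => Soft.input_iff.1 ⟨hs d ▸ h, (CombLabel.inn_tr _ _ _).2 h'⟩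
      have key' : ∀ d b, s.Input o d b → C.label p (Dir.tr o d) = some b ∧ b.inn (Dir.tr o d) :=
        fun d b h => by
          rw [hs, Dir.tr_tr, CombLabel.inn_tr]
          exact Soft.input_iff.2 h
      rcases s.inputs o with ⟨d, b, h1, h2, h3⟩ | ⟨d, b, d', b', hne, h1, h2, h3⟩
      · refine Or.inl ⟨Dir.tr o d, b, key' d b h1, h2, fun e c g g' => ?_⟩
        rw [← h3 _ c (key e c g g'), Dir.tr_tr]
      · refine Or.inr ⟨Dir.tr o d, b, Dir.tr o d', b',
          fun h => hne (by simpa using congrArg (Dir.tr o) h), key' d b h1, key' d' b' h2,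
          fun e c g g' => ?_⟩
        obtain ⟨h4, h5⟩ := h3 _ c (key e c g g')
        refine ⟨h4, h5.imp ?_ ?_⟩ <;> (intro h; rw [← h, Dir.tr_tr])
    · rw [hf.label_eq]
      refine Or.inr ⟨.south, _, .west, _, by simp, ⟨rfl, rfl⟩, ⟨rfl, rfl⟩, fun e c g g' => ?_⟩
      cases e <;> cases g <;> simp_all [CombLabel.inn, Dir.isLow, CombLabel.two]
  determined_one p r hr d b h hin h2 hq hq' := by
    have := received _ hq d.opp b hq' (fun h' => (CombLabel.inn_opp b d).1 h' hin)
      (by rintro o rfl; cases h2)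
    rw [Dir.add_vec_add_opp_vec, Dir.opp_opp] at this
    exact ⟨this.1, determined_one p r this.1 hr h this.2 hin h2⟩
  determined_two p r hr d b e c hde h hin hq hq' g gin hu hu' := by
    -- Fill labels need not be received, so for them the location is identified from both
    -- neighbours. All other labels are received by the tile at `p`, which is then compared with
    -- `r`.
    by_cases hf : ∃ x y : ℕ, C.IsFill x y ∧ r = ((x : ℤ), (y : ℤ))
    · obtain ⟨x, y, hf, rfl⟩ := hf
      have : ∃ x y : ℕ, C.IsFill x y ∧ p = ((x : ℤ), (y : ℤ)) := by
        rw [hf.label_eq] at h g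
        cases d <;> cases h <;> simp [CombLabel.inn, Dir.isLow] at hin <;>
        cases e <;> cases g <;> simp [CombLabel.inn, Dir.isLow] at gin
        · exact absurd rfl hde
        · exact exists_isFill_of_neighbours hq hq' hu hu'
        · exact exists_isFill_of_neighbours hu hu' hq hq'
        · exact absurd rfl hde
      obtain ⟨x', y', hf', rfl⟩ := this
      rw [hf.label_eq, hf'.label_eq]
      exact ⟨mk_mem_region.2 ⟨hf'.lt_x, hf'.lt_y⟩, rfl⟩
    · have h1 := received _ hq d.opp b hq' (fun h' => (CombLabel.inn_opp b d).1 h' hin)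
        (by rintro o rfl; exact hf (exists_isFill_of_label hr h hin))
      have h2 := received _ hu e.opp c hu' (fun h' => (CombLabel.inn_opp c e).1 h' gin)
        (by rintro o rfl; exact hf (exists_isFill_of_label hr g gin))
      rw [Dir.add_vec_add_opp_vec, Dir.opp_opp] at h1 h2
      exact ⟨h1.1, determined_two p r h1.1 hr hde h h1.2 hin g h2.2 gin⟩

/-- A hard-coded location does not share its tile type with another location. -/
theorem IsHard.eq_of_label_eq {p q : Point} (hp : C.IsHard p) (hq : q ∈ C.region)
    (h : C.label q = C.label p) : q = p := by
  by_cases h0 : p = (0, 0)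
  · subst h0
    by_contra hq0
    -- The start is the only tile without inputs.
    have hno : ∀ d b, C.label q d = some b → ¬ b.inn d := fun d b hb =>
      C.blueprint.start_inputs d b ((congrFun h d).symm.trans hb)
    rcases C.blueprint.inputs q hq hq0 with ⟨d, b, ⟨h1, h2⟩, -⟩ | ⟨d, b, -, -, -, ⟨h1, h2⟩, -⟩
    · exact hno d b h1 h2
    · exact hno d b h1 h2
  · obtain ⟨d, h1, h2⟩ := hp.exists_input h0
    rw [← h] at h1
    exact eq_of_label_eq_enter hq h1 h2

/-! ### Counting tile types -/

/-- An enumeration of the counter tiles. -/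
def softOf (p : Point) (b c e : Bool) : ℕ → Soft
  | 0 => .lead p b
  | 1 => .add b c e
  | 2 => .turn b c
  | 3 => .copy b c
  | _ => .home p b c

theorem exists_softOf {H : Finset Point} {p₀ : Point} (hp₀ : p₀ ∈ H) {s : Soft}
    (hs : ∀ p ∈ s.target, p ∈ H) :
    ∃ p ∈ H, ∃ b c e, ∃ i ∈ Finset.range 5, s = softOf p b c e i := by
  cases s with
  | lead p b => exact ⟨p, hs p rfl, b, false, false, 0, by simp, rfl⟩
  | add b c e => exact ⟨p₀, hp₀, b, c, e, 1, by simp, rfl⟩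
  | turn b c => exact ⟨p₀, hp₀, b, c, false, 2, by simp, rfl⟩
  | copy b c => exact ⟨p₀, hp₀, b, c, false, 3, by simp, rfl⟩
  | home p b c => exact ⟨p, hs p rfl, b, c, false, 4, by simp, rfl⟩

/-- The number of tile types is linear in the number of hard-coded locations. -/
theorem card_image_label_le {H : Finset Point} (hH : ∀ p, C.IsHard p → p ∈ H) :
    (C.region.image C.label).card ≤ 82 * H.card := by
  have h0 : ((0, 0) : Point) ∈ H := by
    have h1 := C.two_le
    have h2 := C.h_le
    exact hH _ ⟨none, 0, 0, ⟨by simp, by simp only [wd]; omega, le_rfl, by omega⟩,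
      pr_first_mem none, rfl⟩
  let S : Finset (Bool × Point × (Bool × Bool × Bool) × ℕ) :=
    Finset.univ ×ˢ H ×ˢ Finset.univ ×ˢ Finset.range 5
  have hsub : C.region.image C.label ⊆ H.image C.label ∪
      S.image (fun t d => (softOf t.2.1 t.2.2.1.1 t.2.2.1.2.1 t.2.2.1.2.2 t.2.2.2).label t.1
        (Dir.tr t.1 d)) ∪ {fillLabel} := by
    intro f hmem
    obtain ⟨p, hp, rfl⟩ := Finset.mem_image.1 hmem
    rcases cases_of_mem' hp with hh | ⟨o, s, hs, ht⟩ | ⟨x, y, hf, rfl⟩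
    · exact Finset.mem_union_left _ (Finset.mem_union_left _ (Finset.mem_image_of_mem _ (hH p hh)))
    · obtain ⟨q, hq, b, c, e, i, hi, rfl⟩ := exists_softOf h0 fun q hq => hH q (ht q hq)
      refine Finset.mem_union_left _ (Finset.mem_union_right _ (Finset.mem_image.2
        ⟨(o, q, (b, c, e), i), ?_, (funext hs).symm⟩))
      simp only [S, Finset.mem_product, Finset.mem_univ, true_and]
      exact ⟨hq, hi⟩
    · exact Finset.mem_union_right _ (Finset.mem_singleton.2 hf.label_eq)
  -- Two orientations, eight triples of bits and five kinds of counter tiles. The hard-coded tiles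
  -- and the filling tile raise the factor to 82.
  have hS : S.card = 80 * H.card := by
    simp only [S, Finset.card_product, Finset.card_univ, Finset.card_range, Fintype.card_prod,
      Fintype.card_bool]
    ring
  have hpos : 0 < H.card := Finset.card_pos.2 ⟨_, h0⟩
  calc (C.region.image C.label).card ≤ _ := Finset.card_le_card hsub
    _ ≤ H.card + S.card + 1 :=
      (Finset.card_union_le _ _).trans (Nat.add_le_add ((Finset.card_union_le _ _).trans
        (Nat.add_le_add Finset.card_image_le Finset.card_image_le)) (by simp))
    _ ≤ 82 * H.card := by omega

/-- The number of hard-coded locations is bounded in terms of a set of hard-coded lines. -/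
theorem exists_card_le (U : Finset (Option ℕ × ℕ)) (w : ℕ)
    (hw : ∀ σ a l, C.Valid σ a l → C.wd σ ≤ w)
    (hU : ∀ σ a l, C.Valid σ a l → C.pr l ∈ C.hp σ → ∃ l', (σ, l') ∈ U ∧ C.pr l' = C.pr l) :
    ∃ H : Finset Point, (∀ p, C.IsHard p → p ∈ H) ∧ H.card ≤ U.card * (2 * w) := by
  -- A hard-coded location is recovered from a line of `U` in the same pair, its phase in the pair
  -- and its position across the strip.
  refine ⟨(U ×ˢ Finset.range 2 ×ˢ Finset.range w).image fun t =>
    place t.1.1 t.2.2 (2 * C.pr t.1.2 + t.2.1 - C.n % 2), ?_, ?_⟩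
  · rintro p ⟨σ, a, l, hv, hh, rfl⟩
    obtain ⟨l', hl', hpr⟩ := hU σ a l hv hh
    refine Finset.mem_image.2 ⟨((σ, l'), C.ph l, a), ?_, ?_⟩
    · simp only [Finset.mem_product, Finset.mem_range]
      exact ⟨hl', Nat.mod_lt _ two_pos, hv.lt_wd.trans_le (hw σ a l hv)⟩
    · simp only [hpr]
      congr 1
      unfold pr ph
      omega
  · refine Finset.card_image_le.trans ?_
    simp [Finset.card_product]

end Comb

/-! ### The comb of a set of points -/

/-- The first row of the slab of a row: slabs have height `h`, except for the lowest
one, which has height `h + n % h`. -/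
def slabStart (n h y : ℕ) : ℕ := if y < h + n % h then 0 else n % h + h * ((y - n % h) / h)

/-- The end of a slab. -/
def slabEnd (n h s : ℕ) : ℕ := if s = 0 then h + n % h else s + h

section Slabs

variable {n h : ℕ}

theorem slabStart_eq_of_lt {y : ℕ} (hy : y < h + n % h) : slabStart n h y = 0 := if_pos hy

theorem slabEnd_zero : slabEnd n h 0 = h + n % h := if_pos rfl

/-- The slabs above the lowest one. -/
theorem exists_slab {y : ℕ} (h0 : 0 < h) (hy : h + n % h ≤ y) :
    ∃ k, 1 ≤ k ∧ n % h + h * k ≤ y ∧ y < n % h + h * k + h ∧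
      slabStart n h y = n % h + h * k := by
  refine ⟨(y - n % h) / h, ?_, ?_, ?_, if_neg (not_lt.2 hy)⟩
  · exact (Nat.one_le_div_iff h0).2 (by omega)
  · have := Nat.mul_div_le (y - n % h) h
    omega
  · have := Nat.lt_mul_div_succ (y - n % h) h0
    rw [Nat.mul_add, mul_one] at this
    omega

theorem slabStart_eq {y k : ℕ} (hk : 1 ≤ k) (h1 : n % h + h * k ≤ y)
    (h2 : y < n % h + h * k + h) : slabStart n h y = n % h + h * k := by
  have h3 : h * 1 ≤ h * k := Nat.mul_le_mul_left h hk
  unfold slabStart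
  rw [if_neg (by omega)]
  have : (y - n % h) / h = k := by
    refine Nat.div_eq_of_lt_le ?_ ?_
    · rw [mul_comm]; omega
    · rw [Nat.add_mul, one_mul, mul_comm k]; omega
  rw [this]

theorem slabEnd_eq {k : ℕ} (h0 : 0 < h) (hk : 1 ≤ k) :
    slabEnd n h (n % h + h * k) = n % h + h * k + h := by
  have h3 : h * 1 ≤ h * k := Nat.mul_le_mul_left h hk
  exact if_neg (by omega)

theorem slabEnd_le_two_mul (h0 : 0 < h) (s : ℕ) : slabEnd n h s - s ≤ 2 * h := by
  have := Nat.mod_lt n h0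
  unfold slabEnd
  split_ifs <;> omega

/-- The lowest slab absorbs the remainder of n modulo h, so the others have height exactly h and the
topmost ends at n. -/
theorem slab_spec (h0 : 0 < h) (hn : h ≤ n) {y : ℕ} (hy : y < n) :
    slabStart n h y ≤ y ∧ y < slabEnd n h (slabStart n h y) ∧
    slabEnd n h (slabStart n h y) ≤ n ∧
    (∀ y', slabStart n h y ≤ y' → y' < slabEnd n h (slabStart n h y) →
      slabStart n h y' = slabStart n h y) ∧
    slabStart n h (slabEnd n h (slabStart n h y)) = slabEnd n h (slabStart n h y) ∧
    slabStart n h y + h ≤ slabEnd n h (slabStart n h y) := by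
  have hq := Nat.div_add_mod n h
  have hmod := Nat.mod_lt n h0
  have hq1 : h * 1 ≤ h * (n / h) := Nat.mul_le_mul_left h ((Nat.one_le_div_iff h0).2 hn)
  by_cases hlow : y < h + n % h
  · rw [slabStart_eq_of_lt hlow, slabEnd_zero]
    refine ⟨Nat.zero_le _, hlow, by omega, fun y' _ h' => slabStart_eq_of_lt h', ?_, by omega⟩
    rw [slabStart_eq (k := 1) le_rfl (by omega) (by omega)]
    omega
  · obtain ⟨k, hk, h1, h2, h3⟩ := exists_slab (n := n) h0 (not_lt.1 hlow)
    rw [h3, slabEnd_eq h0 hk]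
    have hkq : k < n / h := Nat.lt_of_mul_lt_mul_left (a := h) (by omega)
    have h4 : h * (k + 1) ≤ h * (n / h) := Nat.mul_le_mul_left h hkq
    have h5 : h * (k + 1) = h * k + h := by ring
    refine ⟨h1, h2, by omega, fun y' h6 h7 => slabStart_eq hk h6 h7, ?_, le_rfl⟩
    rw [slabStart_eq (k := k + 1) (by omega) (by omega) (by omega)]
    omega

theorem slabStart_zero (h0 : 0 < h) : slabStart n h 0 = 0 := slabStart_eq_of_lt (by omega)

theorem slabStart_le (h0 : 0 < h) (y : ℕ) : slabStart n h y ≤ y := by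
  by_cases hlow : y < h + n % h
  · rw [slabStart_eq_of_lt hlow]
    exact Nat.zero_le _
  · obtain ⟨k, -, h1, -, h3⟩ := exists_slab (n := n) h0 (not_lt.1 hlow)
    rw [h3]
    exact h1

theorem slabStart_slabStart (h0 : 0 < h) (y : ℕ) :
    slabStart n h (slabStart n h y) = slabStart n h y := by
  by_cases hlow : y < h + n % h
  · rw [slabStart_eq_of_lt hlow, slabStart_zero h0]
  · obtain ⟨k, hk, -, -, h3⟩ := exists_slab (n := n) h0 (not_lt.1 hlow)
    rw [h3, slabStart_eq hk le_rfl (by omega)]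

end Slabs

/-- The starts of the slabs that meet a set of points, and of the lowest slab. -/
def toothStarts (n h : ℕ) (L : Finset Point) : Finset ℕ :=
  insert 0 (L.image fun p => slabStart n h p.2.toNat)

theorem slabStart_mem_toothStarts {n h : ℕ} {L : Finset Point} {p : Point} (hp : p ∈ L) :
    slabStart n h p.2.toNat ∈ toothStarts n h L := by
  rw [toothStarts, Finset.mem_insert, Finset.mem_image]
  exact Or.inr ⟨p, hp, rfl⟩

/-- The lines of a strip that have to be hard-coded. -/
def hardLines (n h : ℕ) (L : Finset Point) : Option ℕ → Finset ℕ
  | none => insert 0 (insert (n - 1) (toothStarts n h L ∪ L.image fun p => p.2.toNat))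
  | some s => insert h (insert (n - 1)
      ((L.filter fun p => slabStart n h p.2.toNat = s).image fun p => p.1.toNat))

/-- The comb of a set of points. -/
def combOf (n h : ℕ) (L : Finset Point) (h2 : 2 ≤ h) (hn : h ≤ n) (hpow : n ≤ 2 ^ h)
    (hL : ∀ p ∈ L, p ∈ square n) : Comb where
  n := n
  h := h
  st := slabStart n h
  en := slabEnd n h
  teeth := {s | s ∈ toothStarts n h L}
  hp σ := {P | ∃ l ∈ hardLines n h L σ, (l + n % 2) / 2 = P}
  two_le := h2
  h_le := hn
  n_le := hpow
  st_le := slabStart_le (by omega)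
  lt_en y hy := (slab_spec (by omega) hn hy).2.1
  en_le y hy := (slab_spec (by omega) hn hy).2.2.1
  st_eq y hy := (slab_spec (by omega) hn hy).2.2.2.1
  st_en y hy _ := (slab_spec (by omega) hn hy).2.2.2.2.1
  height y hy := (slab_spec (by omega) hn hy).2.2.2.2.2
  zero_mem := Finset.mem_insert_self _ _
  teeth_lt s hs := by
    rcases Finset.mem_insert.1 hs with rfl | hs
    · omega
    · obtain ⟨p, hp, rfl⟩ := Finset.mem_image.1 hs
      obtain ⟨-, -, h3, h4⟩ := hL p hp
      have := slabStart_le (n := n) (h := h) (by omega) p.2.toNat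
      omega
  teeth_st s hs := by
    rcases Finset.mem_insert.1 hs with rfl | hs
    · exact slabStart_zero (by omega)
    · obtain ⟨p, hp, rfl⟩ := Finset.mem_image.1 hs
      exact slabStart_slabStart (by omega) _
  hp_zero := ⟨0, by simp [hardLines], by simp⟩
  hp_teeth s hs := ⟨s, Finset.mem_insert_of_mem (Finset.mem_insert_of_mem
    (Finset.mem_union_left _ hs)), rfl⟩
  hp_h s := ⟨h, by simp [hardLines], rfl⟩
  hp_last σ := ⟨n - 1, by cases σ <;> simp [hardLines], rfl⟩

section CombOf

variable {n h : ℕ} {L : Finset Point} (h2 : 2 ≤ h) (hn : h ≤ n) (hpow : n ≤ 2 ^ h)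
  (hL : ∀ p ∈ L, p ∈ square n)

theorem pr_mem_hp {σ : Option ℕ} {l : ℕ} (hl : l ∈ hardLines n h L σ) :
    (combOf n h L h2 hn hpow hL).pr l ∈ (combOf n h L h2 hn hpow hL).hp σ := ⟨l, hl, rfl⟩

theorem isHard_of_mem {p : Point} (hp : p ∈ L) : (combOf n h L h2 hn hpow hL).IsHard p := by
  obtain ⟨x1, x2, y1, y2⟩ := hL p hp
  have hxn : p.1.toNat < n := by omega
  have hyn : p.2.toNat < n := by omega
  by_cases hx : p.1.toNat < h
  · have hv : (combOf n h L h2 hn hpow hL).Valid none p.1.toNat p.2.toNat := by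
      refine ⟨by simp, ?_, ?_, ?_⟩
      · change p.1.toNat < h
        exact hx
      · change 0 ≤ _
        exact Nat.zero_le _
      · change _ < n
        exact hyn
    refine ⟨none, _, _, hv, pr_mem_hp h2 hn hpow hL ?_, ?_⟩
    · simp only [hardLines, Finset.mem_insert, Finset.mem_union, Finset.mem_image]
      exact Or.inr (Or.inr (Or.inr ⟨p, hp, rfl⟩))
    · ext <;> simp only [Comb.place] <;> omega
  · have hspec := slab_spec (n := n) (h := h) (y := p.2.toNat) (by omega) hn hyn
    have hv : (combOf n h L h2 hn hpow hL).Valid (some (slabStart n h p.2.toNat))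
        (p.2.toNat - slabStart n h p.2.toNat) p.1.toNat := by
      refine ⟨?_, ?_, ?_, ?_⟩
      · simp only [Option.mem_def, Option.some.injEq, forall_eq']
        exact slabStart_mem_toothStarts hp
      · change _ < slabEnd n h _ - _
        omega
      · change h ≤ _
        exact not_lt.1 hx
      · change _ < n
        exact hxn
    refine ⟨_, _, _, hv, pr_mem_hp h2 hn hpow hL ?_, ?_⟩
    · simp only [hardLines, Finset.mem_insert, Finset.mem_image, Finset.mem_filter]
      exact Or.inr (Or.inr ⟨p, ⟨hp, rfl⟩, rfl⟩)
    · ext <;> simp only [Comb.place] <;> omega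

theorem card_image_label_combOf_le (hne : L.Nonempty) :
    ((combOf n h L h2 hn hpow hL).region.image (combOf n h L h2 hn hpow hL).label).card ≤
      3280 * (L.card * h) := by
  let U : Finset (Option ℕ × ℕ) :=
    ({(none, 0), (none, n - 1)} ∪ (toothStarts n h L).image fun s => (none, s)) ∪
      (L.image fun p => (none, p.2.toNat)) ∪
      ((toothStarts n h L).image fun s => (some s, h)) ∪
      ((toothStarts n h L).image fun s => (some s, n - 1)) ∪
      (L.image fun p => (some (slabStart n h p.2.toNat), p.1.toNat))
  have hteeth : (toothStarts n h L).card ≤ L.card + 1 :=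
    (Finset.card_insert_le _ _).trans (Nat.add_le_add_right Finset.card_image_le 1)
  have hU : U.card ≤ 10 * L.card := by
    have hpos : 0 < L.card := Finset.card_pos.2 hne
    -- There are at most |L| + 1 teeth, so the sum is at most 5|L| + 5, and L is non-empty.
    have : U.card ≤ 2 + (toothStarts n h L).card + L.card + (toothStarts n h L).card +
        (toothStarts n h L).card + L.card := by
      refine (Finset.card_union_le _ _).trans (Nat.add_le_add ?_ Finset.card_image_le)
      refine (Finset.card_union_le _ _).trans (Nat.add_le_add ?_ Finset.card_image_le)
      refine (Finset.card_union_le _ _).trans (Nat.add_le_add ?_ Finset.card_image_le)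
      refine (Finset.card_union_le _ _).trans (Nat.add_le_add ?_ Finset.card_image_le)
      exact (Finset.card_union_le _ _).trans (Nat.add_le_add Finset.card_le_two
        Finset.card_image_le)
    omega
  obtain ⟨H, hH, hcard⟩ := Comb.exists_card_le (C := combOf n h L h2 hn hpow hL) U (2 * h)
    (fun σ a l hv => by
      cases σ with
      | none => change h ≤ 2 * h; omega
      | some s => exact slabEnd_le_two_mul (by omega) s)
    (fun σ a l hv ⟨l', hl', hpr⟩ => by
      refine ⟨l', ?_, hpr⟩
      cases σ with
      | none =>
        simp only [hardLines, Finset.mem_insert, Finset.mem_union, Finset.mem_image] at hl'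
        simp only [U, Finset.mem_union, Finset.mem_insert, Finset.mem_singleton, Finset.mem_image,
          Prod.mk.injEq, true_and, reduceCtorEq, false_and, and_false, exists_false, or_false]
        rcases hl' with h | h | h | h
        · exact Or.inl (Or.inl (Or.inl h))
        · exact Or.inl (Or.inl (Or.inr h))
        · exact Or.inl (Or.inr ⟨_, h, rfl⟩)
        · exact Or.inr h
      | some s =>
        have hs : s ∈ toothStarts n h L := hv.mem_teeth s rfl
        simp only [hardLines, Finset.mem_insert, Finset.mem_image, Finset.mem_filter] at hl'
        simp only [U, Finset.mem_union, Finset.mem_image, Prod.mk.injEq, Option.some.injEq]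
        rcases hl' with h | h | ⟨p, ⟨hp, hps⟩, hpl⟩
        · exact Or.inl (Or.inl (Or.inr ⟨s, hs, rfl, h.symm⟩))
        · exact Or.inl (Or.inr ⟨s, hs, rfl, h.symm⟩)
        · exact Or.inr ⟨p, hp, hps, hpl⟩)
  calc _ ≤ 82 * H.card := Comb.card_image_label_le hH
    _ ≤ 82 * (10 * L.card * (2 * (2 * h))) :=
      Nat.mul_le_mul_left _ (hcard.trans (Nat.mul_le_mul_right _ hU))
    _ = 3280 * (L.card * h) := by ring

end CombOf

end ATAM

/-! ### The width ⌊log₂ n⌋ + 1 and the final bound -/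

theorem theorem2 :
    ∃ K : ℝ, ∀ (C : Type*) (black white : C), black ≠ white →
      ∀ (n : ℕ) (L : Finset (ℤ × ℤ)), 2 ≤ n → L.Nonempty →
        (∀ p ∈ L, p ∈ ATAM.square n) →
        (∀ p ∈ L, ∀ q ∈ L, p ≠ q →
          ⌈Real.logb 2 n⌉ ≤ |p.1 - q.1| ∨ ⌈Real.logb 2 n⌉ ≤ |p.2 - q.2|) →
        ∃ (S : ATAM.TAS) (color : S.tiles → C),
          S.temp = 2 ∧ S.SinglySeeded ∧
          (S.tiles.card : ℝ) ≤ K * (L.card * Real.logb 2 n) ∧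
          S.WeaklySelfAssembles color {black, white} (ATAM.multiPixel black white n L) := by
  -- The constant is 2 · 3280, since ⌊log₂ n⌋ + 1 ≤ 2 log₂ n for n ≥ 2.
  refine ⟨6560, fun C black white _ n L hn hne hL _ => ?_⟩
  have hlog : 1 ≤ Nat.log 2 n := Nat.log_pos one_lt_two hn
  have h2 : 2 ≤ Nat.log 2 n + 1 := by omega
  have hle : Nat.log 2 n + 1 ≤ n := Nat.log_lt_self 2 (by omega)
  have hpow : n ≤ 2 ^ (Nat.log 2 n + 1) := (Nat.lt_pow_succ_log_self one_lt_two n).le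
  set B := ATAM.combOf n (Nat.log 2 n + 1) L h2 hle hpow hL with hB
  obtain ⟨S, color, h1, h3, h4, h5⟩ := B.blueprint.exists_weaklySelfAssembles
    (black := black) (white := white) (L := L) (P := ATAM.multiPixel black white n L)
    (fun p hp q hq h => by
      rw [(ATAM.isHard_of_mem h2 hle hpow hL hp).eq_of_label_eq hq h]
      exact hp)
    (fun q => by
      have : q.1 ∈ B.blueprint.region ↔ q.1 ∈ ATAM.square n := by
        change q.1 ∈ B.region ↔ _
        rw [ATAM.Comb.mem_region]
        constructor
        · rintro ⟨x, y, hx, hy, h⟩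
          have hx' : x < n := hx
          have hy' : y < n := hy
          rw [h]
          refine ⟨?_, ?_, ?_, ?_⟩ <;> simp only <;> omega
        · rintro ⟨x1, x2, y1, y2⟩
          refine ⟨q.1.1.toNat, q.1.2.toNat, ?_, ?_, ?_⟩
          · change _ < n
            omega
          · change _ < n
            omega
          · ext <;> simp only <;> omega
      rw [this, ATAM.multiPixel, Set.mem_ofPred_eq])
  refine ⟨S, color, h1, h3, ?_, h5⟩
  have h6 : S.tiles.card ≤ 3280 * (L.card * (Nat.log 2 n + 1)) :=
    h4.trans (ATAM.card_image_label_combOf_le h2 hle hpow hL hne)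
  have h7 : (Nat.log 2 n : ℝ) ≤ Real.logb 2 n := by
    exact_mod_cast Real.natLog_le_logb n 2
  have h8 : (1 : ℝ) ≤ Nat.log 2 n := by exact_mod_cast hlog
  have h9 : (0 : ℝ) ≤ L.card := Nat.cast_nonneg _
  calc (S.tiles.card : ℝ) ≤ 3280 * (L.card * (Nat.log 2 n + 1)) := by exact_mod_cast h6
    _ ≤ 3280 * (L.card * (2 * Real.logb 2 n)) := by gcongr; linarith
    _ = 6560 * (L.card * Real.logb 2 n) := by ring
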